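/- **Setting.** Let a CSS code on $n$ qubits be given by finitely many $X$-stabilizers $X^{\otimes S}$ and $Z$-stabilizers $Z^{\otimes S}$ ($S\subseteq\{1,\dots,n\}$, every $X$-support meeting every $Z$-support in an even number of qubits), and let $V$ be an encoder, i.e. an isometry from $k$ qubits onto the joint $+1$ eigenspace of all stabilizers. The foliation circuit with $L$ rounds acts on $n$ code qubits that start in a code state, and has steps $t=1,\dots,2L$. In step $t$: (i) each code qubit $i$ is teleported to a fresh qubit $(i,t)$ prepared in $|+\rangle$, by a CZ gate followed by an $X$-basis measurement of the old qubit with outcome $m_{i,t}\in\{0,1\}$; (ii) each $X$-stabilizer ($t$ odd) or each $Z$-stabilizer ($t$ even) is measured with an ancilla prepared in $|+\rangle$, coupled by CZ gates, in any order, to the fresh qubits in the support of the stabilizer, and measured in the $X$ basis, with outcomes $\vec s_t$. A single-qubit channel $\mathcal N_{\gamma,w}$, $w=1,\dots,W_\gamma$, acts on each physical qubit $\gamma$ (a fresh code qubit $(i,t)$ or an ancilla of step $t$, $1\le t\le 2L$) after its preparation and after each of the $W_\gamma-1$ CZ gates acting on it; the initial code qubits carry no noise. At the end the Pauli frame $X^{m_{i,2}+m_{i,4}+\dots+m_{i,2L}}Z^{m_{i,1}+m_{i,3}+\dots+m_{i,2L-1}}$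 on each code qubit $i$ is undone, and a decoding and recovery channel $\mathcal R_\sigma$ from $n$ to $k$ qubits is applied, which depends on the outcomes only through the cluster-state stabilizer outcomes $\sigma=(\vec s_t+\vec s_{t-2}+\vec u_t)_{t}$ (mod 2), where $\vec u_t$ sums the $m_{i,t}$ over the support of each stabilizer and $\vec s_{-1}=\vec s_0=0$. Averaging over all measurement outcomes gives the average logical channel $\mathcal E_{\rm L}[\{\mathcal N_{\gamma,w}\}]$ on $k$ qubits. **Assumption.** Every $\mathcal N=\mathcal N_{\gamma,w}$ is a channel with pure $Z$-coherences: with $[\mathcal N]_{P,P'}=\tfrac12\mathrm{Tr}[P^\dagger\mathcal N(P')]$, one has $[\mathcal N]_{P,XP}=[\mathcal N]_{P,YP}=0$ for all $P\in\{I,X,Y,Z\}$ and $[\mathcal N]_{Z,Z}=1$. **Replacement.** Let $b_\gamma$ be the probability of $Z$ in the Pauli twirl of the composition $\mathcal N_{\gamma,W_\gamma}\circ\cdots\circ\mathcal N_{\gamma,1}$ (so $b_\gamma=|\beta|^2$ if this composition is $N\cdot N^\dagger$ with $N=\alpha I+\beta Z$). Put $\mathcal F_{\gamma,w}(\rho)=(1-p_{\gamma,w})\rho+p_{\gamma,w}Z\rho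 Z$ with $$p_{\gamma,w}=\tfrac12\Bigl(1-\sqrt[W_\gamma]{1-2b_\gamma}\Bigr),$$ the root being the real one. If $W_\gamma$ is even and $b_\gamma>\tfrac12$, where there is no real root, put $p_{\gamma,1}=\tfrac12(1+\sqrt[W_\gamma]{2b_\gamma-1})$ and $p_{\gamma,w}=\tfrac12(1-\sqrt[W_\gamma]{2b_\gamma-1})$ for $w\ge2$. **Claim.** All $p_{\gamma,w}$ lie in $[0,1]$, so that the $\mathcal F_{\gamma,w}$ are Pauli channels, and replacing the noise by them does not change the average logical channel: $$\mathcal E_{\rm L}[\{\mathcal N_{\gamma,w}\}]=\mathcal E_{\rm L}[\{\mathcal F_{\gamma,w}\}].$$ Hence the logical channel under the coherent noise is obtained exactly from Clifford circuits with random Pauli gates: $\mathcal E_{\rm L}[\{\mathcal N_{\gamma,w}\}]$ is the expectation of the average logical channel of the noiseless foliation circuit with a gate $Z^{e_{\gamma,w}}$ inserted at each location, where the bits $e_{\gamma,w}$ are independent and $e_{\gamma,w}=1$ has probability $p_{\gamma,w}$. -/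

import Mathlib

open scoped BigOperators Matrix

noncomputable section

namespace Foliation

/-! ### Qubits, Pauli operators, channels -/

/-- Classical bits; they also label the computational basis of a qubit. -/
abbrev Bit := ZMod 2

/-- Operators on the qubits labelled by `Q`, in the computational basis. -/
abbrev Op (Q : Type*) := Matrix (Q → Bit) (Q → Bit) ℂ

abbrev QubitOp := Matrix Bit Bit ℂ

/-- Linear maps on the operators of one qubit. -/
abbrev QubitMap := QubitOp →ₗ[ℂ] QubitOp

/-- `(-1)^b`. -/
def sgn (b : Bit) : ℂ := (-1) ^ b.val

def pauliX : QubitOp := Matrix.of fun a b => if a = b + 1 then 1 else 0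

def pauliZ : QubitOp := Matrix.diagonal sgn

def pauliY : QubitOp := Complex.I • (pauliX * pauliZ)

/-- `I, X, Y, Z`. -/
def pauli : Fin 4 → QubitOp := ![1, pauliX, pauliY, pauliZ]

/-- The map `ρ ↦ A ρ A†`. -/
def conjBy {α β : Type*} [Fintype α] (A : Matrix β α ℂ) :
    Matrix α α ℂ →ₗ[ℂ] Matrix β β ℂ where
  toFun ρ := A * ρ * Aᴴ
  map_add' ρ σ := by rw [Matrix.mul_add, Matrix.add_mul]
  map_smul' c ρ := by simp

/-- Quantum channels, in Kraus form. -/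
def IsChannel {α β : Type*} [Fintype α] [DecidableEq α] [Fintype β]
    (Φ : Matrix α α ℂ →ₗ[ℂ] Matrix β β ℂ) : Prop :=
  ∃ (d : ℕ) (K : Fin d → Matrix β α ℂ),
    ∑ j, (K j)ᴴ * K j = 1 ∧ ∀ ρ, Φ ρ = ∑ j, K j * ρ * (K j)ᴴ

/-- `Φ(ρ) = ∑ p_E E ρ E†` over `E = I, X, Y, Z`, with `p` a probability vector. -/
def IsPauliChannel (Φ : QubitMap) : Prop :=
  ∃ p : Fin 4 → ℝ, (∀ j, 0 ≤ p j) ∧ ∑ j, p j = 1 ∧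
    ∀ ρ, Φ ρ = ∑ j, (p j : ℂ) • (pauli j * ρ * (pauli j)ᴴ)

/-- Entry `[Φ]_{P,P'} = Tr[P† Φ(P')] / 2` of the Pauli transfer matrix. -/
def ptm (Φ : QubitMap) (P P' : QubitOp) : ℂ := (Pᴴ * Φ P').trace / 2

/-- A single-qubit channel with pure `Z`-coherences. -/
structure IsPureZCoherent (Φ : QubitMap) : Prop where
  channel : IsChannel Φ
  no_x : ∀ j, ptm Φ (pauli j) (pauliX * pauli j) = 0
  no_y : ∀ j, ptm Φ (pauli j) (pauliY * pauli j) = 0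
  zz : ptm Φ pauliZ pauliZ = 1

/-- The channel `ρ ↦ (1 - p) ρ + p Z ρ Z`. -/
def phaseFlip (p : ℝ) : QubitMap :=
  ((1 - p : ℝ) : ℂ) • LinearMap.id + (p : ℂ) • conjBy pauliZ

/-- Tensor product of single-qubit operators. -/
def tensor {Q : Type*} [Fintype Q] (A : Q → QubitOp) : Op Q :=
  Matrix.of fun z z' => ∏ q, A q (z q) (z' q)

/-- `Φ` on qubit `q` and the identity on all other qubits. -/
def applyAt {Q : Type*} [DecidableEq Q] (q : Q) (Φ : QubitMap) (ρ : Op Q) : Op Q :=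
  Matrix.of fun z z' =>
    Φ (Matrix.of fun a b => ρ (Function.update z q a) (Function.update z' q b)) (z q) (z' q)

/-- The controlled-`Z` gate. -/
def czGate {Q : Type*} [Fintype Q] [DecidableEq Q] (a b : Q) : Op Q :=
  Matrix.diagonal fun z => sgn (z a * z b)

/-! ### Circuits of CZ gates and single-qubit noise -/

inductive Instr (Q : Type) where
  | cz (a b : Q)
  | noise (q : Q) (Φ : QubitMap)

def Instr.apply {Q : Type} [Fintype Q] [DecidableEq Q] : Instr Q → Op Q → Op Q
  | .cz a b, ρ => conjBy (czGate a b) ρ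
  | .noise q Φ, ρ => applyAt q Φ ρ

/-- Run the instructions from left to right. -/
def runInstrs {Q : Type} [Fintype Q] [DecidableEq Q] (c : List (Instr Q)) (ρ : Op Q) : Op Q :=
  c.foldl (fun ρ g => g.apply ρ) ρ

/-- Adjoin qubits `B`, each prepared in the state `|+⟩`. -/
def attachPlus {A B : Type} [Fintype B] (ρ : Op A) : Op (A ⊕ B) :=
  Matrix.of fun z z' => ρ (z ∘ Sum.inl) (z' ∘ Sum.inl) *
    tensor (fun _ : B => Matrix.of fun _ _ => 1 / 2) (z ∘ Sum.inr) (z' ∘ Sum.inr)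

/-- The amplitude `⟨+|z⟩` (for `m = 0`) or `⟨-|z⟩` (for `m = 1`). -/
def xBra (m z : Bit) : ℂ := sgn (m * z) / (Real.sqrt 2 : ℂ)

/-- The Kraus operator of measuring the qubits `A` and `B` in the `X` basis with outcomes `m`
and `s` and discarding them; the qubits `F` are kept. -/
def measKraus {A F B : Type} [Fintype A] [Fintype F] [Fintype B] (m : A → Bit) (s : B → Bit) :
    Matrix (F → Bit) ((A ⊕ (F ⊕ B)) → Bit) ℂ :=
  Matrix.of fun y z =>
    if (fun i => z (Sum.inr (Sum.inl i))) = y then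
      (∏ i, xBra (m i) (z (Sum.inl i))) * ∏ p, xBra (s p) (z (Sum.inr (Sum.inr p)))
    else 0

/-! ### CSS codes -/

inductive Kind where
  | X
  | Z
  deriving DecidableEq

instance : Fintype Kind := ⟨{Kind.X, Kind.Z}, fun κ => by cases κ <;> simp⟩

def Kind.pauli : Kind → QubitOp
  | .X => pauliX
  | .Z => pauliZ

/-- A CSS code on `n` qubits given by the supports of its `X` and `Z` stabilizers. -/
structure CSSCode (n : ℕ) where
  num : Kind → ℕ
  supp : (κ : Kind) → Fin (num κ) → Finset (Fin n)
  even_inter : ∀ p q, Even (supp .X p ∩ supp .Z q).card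

namespace CSSCode

variable {n : ℕ} (C : CSSCode n)

/-- The stabilizer generator `X^{⊗S}` or `Z^{⊗S}`. -/
def stab (κ : Kind) (p : Fin (C.num κ)) : Op (Fin n) :=
  tensor fun i => if i ∈ C.supp κ p then κ.pauli else 1

/-- `V` is an isometry from `k` qubits onto the joint `+1` eigenspace of the stabilizers. -/
def IsEncoder {k : ℕ} (V : Matrix (Fin n → Bit) (Fin k → Bit) ℂ) : Prop :=
  Vᴴ * V = 1 ∧
    ∀ ψ : (Fin n → Bit) → ℂ, (∃ φ, V *ᵥ φ = ψ) ↔ ∀ κ p, C.stab κ p *ᵥ ψ = ψ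

/-! ### The foliation circuit

The time steps `t = 1, …, 2L` are written as pairs `(r, κ)` with `r < L`: step `t = 2r + 1` is
`(r, X)` and step `t = 2r + 2` is `(r, Z)`. In step `(r, κ)` every code qubit is teleported onto a
fresh qubit and the stabilizers of kind `κ` are measured through ancillas. -/

/-- The order in which the CZ gates between ancillas and code qubits are executed in each step. -/
structure Schedule (L : ℕ) where
  gates : Fin L → (κ : Kind) → List (Fin (C.num κ) × Fin n)
  nodup : ∀ r κ, (gates r κ).Nodup
  mem_iff : ∀ r κ p i, (p, i) ∈ gates r κ ↔ i ∈ C.supp κ p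

/-- The physical qubits that suffer noise: `inl (r, κ, i)` is the qubit onto which code qubit `i`
is teleported in step `(r, κ)`, and `inr (r, ⟨κ, p⟩)` is the ancilla measuring stabilizer `p` of
kind `κ` in step `(r, κ)`. -/
abbrev PhysQubit (L : ℕ) := (Fin L × Kind × Fin n) ⊕ (Fin L × Σ κ : Kind, Fin (C.num κ))

/-- The number of noise locations on a physical qubit: one after its preparation and one after
each CZ gate acting on it (teleportation onto it, stabilizer measurements, and, except for the
output qubits, teleportation to the next qubit). -/
def numLoc {L : ℕ} : C.PhysQubit L → ℕ
  | .inl (r, κ, i) =>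
      2 + (Finset.univ.filter fun p => i ∈ C.supp κ p).card +
        (if κ = Kind.Z ∧ r.val + 1 = L then 0 else 1)
  | .inr (_, ⟨κ, p⟩) => 1 + (C.supp κ p).card

/-- A noise map for each physical qubit `γ` and location `w` on it. Only the locations
`w < C.numLoc γ` occur in the circuit. -/
abbrev Noise (L : ℕ) := C.PhysQubit L → ℕ → QubitMap

/-- The qubits present during a step: the old code qubits, the fresh ones, the ancillas. -/
abbrev Reg (κ : Kind) := Fin n ⊕ (Fin n ⊕ Fin (C.num κ))

variable {C} {L : ℕ}

/-- The last noise location of the code qubit that enters step `(r, κ)`, after its CZ gate with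
the fresh qubit. The input qubits of the whole circuit carry no noise. -/
def lastNoise (N : C.Noise L) (r : Fin L) : Kind → Fin n → QubitMap
  | .Z, i => N (.inl (r, .X, i)) (C.numLoc (L := L) (.inl (r, .X, i)) - 1)
  | .X, i =>
      if 0 < r.val then
        let r' : Fin L := ⟨r.val - 1, lt_of_le_of_lt (Nat.sub_le _ _) r.isLt⟩
        N (.inl (r', .Z, i)) (C.numLoc (L := L) (.inl (r', .Z, i)) - 1)
      else LinearMap.id

/-- Noise after the preparation of the fresh qubits and ancillas. -/
def prepInstrs (N : C.Noise L) (r : Fin L) (κ : Kind) : List (Instr (C.Reg κ)) :=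
  ((List.finRange n).map fun i =>
      Instr.noise (Sum.inr (Sum.inl i)) (N (.inl (r, κ, i)) 0)) ++
  ((List.finRange (C.num κ)).map fun p =>
      Instr.noise (Sum.inr (Sum.inr p)) (N (.inr (r, ⟨κ, p⟩)) 0))

/-- The CZ gates of the teleportations, each followed by noise on both qubits. -/
def teleInstrs (N : C.Noise L) (r : Fin L) (κ : Kind) : List (Instr (C.Reg κ)) :=
  (List.finRange n).flatMap fun i =>
    [Instr.cz (Sum.inl i) (Sum.inr (Sum.inl i)),
     Instr.noise (Sum.inl i) (lastNoise N r κ i),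
     Instr.noise (Sum.inr (Sum.inl i)) (N (.inl (r, κ, i)) 1)]

/-- The CZ gates of the stabilizer measurements, each followed by noise on both qubits. The first
list holds the gates already executed, and is used to number the noise locations. -/
def checkInstrs (N : C.Noise L) (r : Fin L) (κ : Kind) :
    List (Fin (C.num κ) × Fin n) → List (Fin (C.num κ) × Fin n) → List (Instr (C.Reg κ))
  | _, [] => []
  | done, (p, i) :: todo =>
      Instr.cz (Sum.inr (Sum.inr p)) (Sum.inr (Sum.inl i)) ::
      Instr.noise (Sum.inr (Sum.inr p))
        (N (.inr (r, ⟨κ, p⟩)) (1 + done.countP fun g => g.1 = p)) ::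
      Instr.noise (Sum.inr (Sum.inl i))
        (N (.inl (r, κ, i)) (2 + done.countP fun g => g.2 = i)) ::
      checkInstrs N r κ ((p, i) :: done) todo

/-- All gates and noise of step `(r, κ)` between the preparations and the measurements. -/
def stepInstrs (sch : C.Schedule L) (N : C.Noise L) (r : Fin L) (κ : Kind) :
    List (Instr (C.Reg κ)) :=
  prepInstrs N r κ ++ teleInstrs N r κ ++ checkInstrs N r κ [] (sch.gates r κ)

/-- The unnormalized effect of step `(r, κ)` on the code qubits, given the teleportation outcomes
`m` and the stabilizer outcomes `s`. -/
def step (sch : C.Schedule L) (N : C.Noise L) (r : Fin L) (κ : Kind)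
    (m : Fin n → Bit) (s : Fin (C.num κ) → Bit) (ρ : Op (Fin n)) : Op (Fin n) :=
  conjBy (measKraus m s)
    (runInstrs (stepInstrs sch N r κ) (attachPlus (B := Fin n ⊕ Fin (C.num κ)) ρ))

variable (C L) in
/-- The outcomes `(m, s)` of all teleportations and stabilizer measurements. -/
abbrev Outcome := Fin L → (κ : Kind) → (Fin n → Bit) × (Fin (C.num κ) → Bit)

variable (C L) in
/-- One bit for each stabilizer measurement. -/
abbrev Syndrome := Fin L → (κ : Kind) → Fin (C.num κ) → Bit

/-- The unnormalized state after all `2L` steps, given all outcomes. -/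
def branch (sch : C.Schedule L) (N : C.Noise L) (o : C.Outcome L) (ρ : Op (Fin n)) :
    Op (Fin n) :=
  (List.finRange L).foldl
    (fun ρ r => step sch N r .Z (o r .Z).1 (o r .Z).2 (step sch N r .X (o r .X).1 (o r .X).2 ρ)) ρ

/-- The cluster state stabilizer outcomes `s_t + s_{t-2} + u_t(m_t)`, where `u_t` sums the
teleportation outcomes over the support of the stabilizer and `s_{-1} = s_0 = 0`. -/
def syndrome (o : C.Outcome L) : C.Syndrome L := fun r κ p =>
  (o r κ).2 p +
  (if 0 < r.val then
    (o ⟨r.val - 1, lt_of_le_of_lt (Nat.sub_le _ _) r.isLt⟩ κ).2 p else 0) +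
  ∑ i ∈ C.supp κ p, (o r κ).1 i

/-- The Pauli frame `X^{m_2 + m_4 + ⋯ + m_{2L}} Z^{m_1 + m_3 + ⋯ + m_{2L-1}}` on each code
qubit. -/
def frame (o : C.Outcome L) : Op (Fin n) :=
  tensor fun i =>
    pauliX ^ (∑ r, (o r .Z).1 i).val * pauliZ ^ (∑ r, (o r .X).1 i).val

/-- The average logical channel: encode, run the noisy foliation circuit, undo the Pauli frame,
apply the decoding and recovery operation `R σ` chosen from the cluster state stabilizer outcomes
`σ`, and sum over all measurement outcomes (the branches carry their probabilities). -/
def logicalChannel {k : ℕ} (sch : C.Schedule L) (V : Matrix (Fin n → Bit) (Fin k → Bit) ℂ)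
    (R : C.Syndrome L → Op (Fin n) →ₗ[ℂ] Op (Fin k)) (N : C.Noise L)
    (ρ : Op (Fin k)) : Op (Fin k) :=
  ∑ o : C.Outcome L,
    R (syndrome o) (conjBy (frame o)ᴴ (branch sch N o (conjBy V ρ)))

/-! ### The Pauli channels replacing the coherent noise -/

/-- The composition of all noise maps on a physical qubit, in temporal order. -/
def lumped (N : C.Noise L) (γ : C.PhysQubit L) : QubitMap :=
  (List.range (C.numLoc γ)).foldl (fun Ψ w => N γ w ∘ₗ Ψ) LinearMap.id

/-- The weight of `Z · Z` in `Φ`, that is, the `Z` probability of its Pauli twirl. For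
`Φ = ∑ c_k N_k · N_k†` with `N_k = α_k I + β_k Z` this is `∑ c_k |β_k|²`. -/
def zWeight (Φ : QubitMap) : ℝ :=
  ((ptm Φ 1 1 - ptm Φ pauliX pauliX - ptm Φ pauliY pauliY + ptm Φ pauliZ pauliZ) / 4).re

/-- Real numbers indexed by `w < W` with product `x`: each is the real `W`-th root of `x` if there
is one. If `x < 0` and `W` is even, they are the `W`-th root of `|x|` with the sign of one of them
changed. -/
def splitRoot (x : ℝ) (W w : ℕ) : ℝ :=
  if 0 ≤ x then x ^ (1 / W : ℝ)
  else if Odd W ∨ w = 0 then -((-x) ^ (1 / W : ℝ))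
  else (-x) ^ (1 / W : ℝ)

/-- The phase flip probability at location `w` on `γ`: `(1 - (1 - 2|β_γ|²)^{1/W}) / 2`. -/
def flipProb (N : C.Noise L) (γ : C.PhysQubit L) (w : ℕ) : ℝ :=
  (1 - splitRoot (1 - 2 * zWeight (lumped N γ)) (C.numLoc γ) w) / 2

/-- The Pauli channels replacing the noise maps. -/
def pauliReplacement (N : C.Noise L) : C.Noise L := fun γ w => phaseFlip (flipProb N γ w)

variable (C L) in
/-- A choice of Pauli gate `Z^e` at each noise location. -/
abbrev ErrorConfig := (γ : C.PhysQubit L) → Fin (C.numLoc γ) → Bit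

/-- The foliation circuit in which the noise is the fixed Pauli gate `Z^e` at each location. -/
def insertPaulis (e : C.ErrorConfig L) : C.Noise L := fun γ w =>
  if h : w < C.numLoc γ then conjBy (pauliZ ^ (e γ ⟨w, h⟩).val) else LinearMap.id

/-- The probability of `e` when each location independently has `Z` with probability
`flipProb`. -/
def configProb (N : C.Noise L) (e : C.ErrorConfig L) : ℝ :=
  ∏ γ, ∏ w : Fin (C.numLoc γ),
    if e γ w = 1 then flipProb N γ w else 1 - flipProb N γ w

end CSSCode

end Foliation

end

/-!
A channel with pure `Z`-coherences has diagonal Kraus operators, so it multiplies each matrix entry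
by a coefficient. Hence the noise commutes with the CZ gates, and all noise on a physical qubit
amounts to one multiplier. Expand the circuit in pairs of computational paths `x`, `x'`, which
assign a bit to every physical qubit. Shifting both paths by `w` changes the state by a Pauli
operator; for a suitable change of the outcomes, which leaves the syndrome unchanged, this operator
is undone by the Pauli frame. So the contribution of a pair to the logical channel depends only on
`x + x'`, and the noise on a physical qubit enters only through the sums of its multiplier over the
pairs of bits with a given sum: the trace, which is preserved, and twice the real part of the
coefficient of the coherences. The phase flips are chosen to have the same product of coefficients.
-/

noncomputable section

namespace Foliation

open CSSCode

/-! ### Signs of bits -/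

theorem bit_eq_zero_or_one (a : Bit) : a = 0 ∨ a = 1 := by
  revert a; decide

theorem sum_bit {M : Type*} [AddCommMonoid M] (f : Bit → M) : ∑ b, f b = f 0 + f 1 :=
  Fin.sum_univ_two f

@[simp] theorem sgn_zero : sgn 0 = 1 := by simp [sgn]

@[simp] theorem sgn_one : sgn 1 = -1 := by simp [sgn, ZMod.val_one]

theorem sgn_add (a b : Bit) : sgn (a + b) = sgn a * sgn b := by
  rcases bit_eq_zero_or_one a with rfl | rfl <;> rcases bit_eq_zero_or_one b with rfl | rfl <;>
    simp [CharTwo.add_self_eq_zero]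

@[simp] theorem sgn_mul_self (a : Bit) : sgn a * sgn a = 1 := by
  rw [← sgn_add, CharTwo.add_self_eq_zero, sgn_zero]

@[simp] theorem star_sgn (a : Bit) : star (sgn a) = sgn a := by
  rcases bit_eq_zero_or_one a with rfl | rfl <;> simp

theorem sgn_sum {ι : Type*} (s : Finset ι) (f : ι → Bit) :
    sgn (∑ i ∈ s, f i) = ∏ i ∈ s, sgn (f i) := by
  classical
  induction s using Finset.induction_on with
  | empty => simp
  | insert a s ha ih => rw [Finset.sum_insert ha, Finset.prod_insert ha, sgn_add, ih]

theorem sgn_dotProduct {ι : Type*} [Fintype ι] (f g : ι → Bit) :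
    sgn (f ⬝ᵥ g) = ∏ i, sgn (f i * g i) := sgn_sum _ _

/-! ### Schur multipliers -/

/-- The multiplier of `Φ`, meaningful only if `Φ` acts by entrywise multiplication. -/
def schurCoeff (Φ : QubitMap) (a b : Bit) : ℂ := Φ (Matrix.of fun _ _ => 1) a b

/-- `Φ` is a Schur multiplier: it acts by entrywise multiplication in the computational basis. -/
def IsSchur (Φ : QubitMap) : Prop := ∀ ρ a b, Φ ρ a b = schurCoeff Φ a b * ρ a b

theorem schurCoeff_eq {Φ : QubitMap} {c : Bit → Bit → ℂ} (h : ∀ ρ a b, Φ ρ a b = c a b * ρ a b)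
    (a b : Bit) : schurCoeff Φ a b = c a b := by
  simp [schurCoeff, h]

theorem isSchur_of_forall {Φ : QubitMap} {c : Bit → Bit → ℂ}
    (h : ∀ ρ a b, Φ ρ a b = c a b * ρ a b) : IsSchur Φ := fun ρ a b => by
  rw [schurCoeff_eq h, h]

@[simp] theorem schurCoeff_id (a b : Bit) : schurCoeff LinearMap.id a b = 1 := by
  simp [schurCoeff]

theorem isSchur_id : IsSchur LinearMap.id := fun ρ a b => by
  rw [schurCoeff_id, one_mul, LinearMap.id_apply]

theorem comp_apply_of_isSchur {Φ Ψ : QubitMap} (hΦ : IsSchur Φ) (hΨ : IsSchur Ψ) (ρ : QubitOp)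
    (a b : Bit) : (Φ ∘ₗ Ψ) ρ a b = schurCoeff Φ a b * schurCoeff Ψ a b * ρ a b := by
  rw [LinearMap.comp_apply, hΦ, hΨ, mul_assoc]

theorem conjBy_diagonal_apply {α : Type*} [Fintype α] [DecidableEq α] (d : α → ℂ)
    (ρ : Matrix α α ℂ) (a b : α) :
    conjBy (Matrix.diagonal d) ρ a b = d a * star (d b) * ρ a b := by
  simp only [conjBy, LinearMap.coe_mk, AddHom.coe_mk, Matrix.diagonal_conjTranspose,
    Matrix.mul_diagonal, Matrix.diagonal_mul, Pi.star_apply]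
  ring

theorem conjBy_pauliZ_pow_apply (g : Bit) (ρ : QubitOp) (a b : Bit) :
    conjBy (pauliZ ^ g.val) ρ a b = sgn (g * (a + b)) * ρ a b := by
  rw [pauliZ, Matrix.diagonal_pow, conjBy_diagonal_apply]
  rcases bit_eq_zero_or_one g with rfl | rfl
  · simp
  · simp [ZMod.val_one, sgn_add]

theorem phaseFlip_apply (p : ℝ) (ρ : QubitOp) (a b : Bit) :
    phaseFlip p ρ a b = ((1 - p : ℝ) + p * sgn (a + b)) * ρ a b := by
  have h : conjBy pauliZ ρ a b = sgn (a + b) * ρ a b := by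
    simpa [ZMod.val_one] using conjBy_pauliZ_pow_apply 1 ρ a b
  simp only [phaseFlip, LinearMap.add_apply, LinearMap.smul_apply, LinearMap.id_apply,
    Matrix.add_apply, Matrix.smul_apply, h, smul_eq_mul]
  ring

theorem isPauliChannel_phaseFlip {p : ℝ} (hp : p ∈ Set.Icc (0 : ℝ) 1) :
    IsPauliChannel (phaseFlip p) := by
  refine ⟨![1 - p, 0, 0, p], fun j => ?_, ?_, fun ρ => ?_⟩
  · fin_cases j <;> simp [hp.1, hp.2]
  · simp [Fin.sum_univ_four]
  · ext a b
    simp [Fin.sum_univ_four, phaseFlip, pauli, conjBy]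

/-! ### Channels with pure `Z`-coherences -/

theorem pauliX_apply (a b : Bit) : pauliX a b = if a = b + 1 then 1 else 0 := rfl

theorem pauliZ_apply (a b : Bit) : pauliZ a b = if a = b then sgn a else 0 := by
  simp [pauliZ, Matrix.diagonal_apply]

theorem pauliY_apply (a b : Bit) :
    pauliY a b = if a = b + 1 then Complex.I * sgn b else 0 := by
  simp [pauliY, pauliZ, Matrix.mul_diagonal, pauliX_apply]

theorem trace_conj_pauliZ (K : QubitOp) :
    (pauliZᴴ * (K * pauliZ * Kᴴ)).trace =
      ((Complex.normSq (K 0 0) - Complex.normSq (K 0 1) - Complex.normSq (K 1 0) +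
        Complex.normSq (K 1 1) : ℝ) : ℂ) := by
  simp only [pauliZ, Matrix.diagonal_conjTranspose, Matrix.trace, Matrix.diag_apply,
    Matrix.diagonal_mul, Pi.star_apply, star_sgn, Matrix.mul_apply (N := Kᴴ), Matrix.mul_diagonal,
    Matrix.conjTranspose_apply, sum_bit, sgn_zero, sgn_one, Complex.ofReal_add, Complex.ofReal_sub,
    Complex.normSq_eq_conj_mul_self, Complex.star_def]
  ring

theorem conjTranspose_mul_self_apply (K : QubitOp) (a : Bit) :
    (Kᴴ * K) a a = ((Complex.normSq (K 0 a) + Complex.normSq (K 1 a) : ℝ) : ℂ) := by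
  simp only [Matrix.mul_apply, sum_bit, Matrix.conjTranspose_apply, Complex.ofReal_add,
    Complex.normSq_eq_conj_mul_self, Complex.star_def]

theorem kraus_apply_eq_zero_of_ne {ι : Type*} [Fintype ι] {K : ι → QubitOp}
    (hK : ∑ j, (K j)ᴴ * K j = 1) (hZ : ∑ j, (pauliZᴴ * (K j * pauliZ * (K j)ᴴ)).trace = 2)
    (j : ι) {a b : Bit} (hab : a ≠ b) : K j a b = 0 := by
  have hcol : ∀ a, ∑ j, (Complex.normSq (K j 0 a) + Complex.normSq (K j 1 a)) = 1 := fun a => by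
    have h := congrFun₂ hK a a
    simp only [Matrix.sum_apply, conjTranspose_mul_self_apply, Matrix.one_apply_eq] at h
    exact_mod_cast h
  have hdiff : ∑ j, (Complex.normSq (K j 0 0) - Complex.normSq (K j 0 1) -
      Complex.normSq (K j 1 0) + Complex.normSq (K j 1 1)) = 2 := by
    simp only [trace_conj_pauliZ] at hZ
    exact_mod_cast hZ
  have hoff : ∑ j, (Complex.normSq (K j 0 1) + Complex.normSq (K j 1 0)) = 0 := by
    have h0 := hcol 0
    have h1 := hcol 1
    simp only [Finset.sum_add_distrib, Finset.sum_sub_distrib] at h0 h1 hdiff ⊢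
    linarith
  rw [Finset.sum_eq_zero_iff_of_nonneg
    fun j _ => add_nonneg (Complex.normSq_nonneg _) (Complex.normSq_nonneg _)] at hoff
  have hj := hoff j (Finset.mem_univ j)
  have h01 := Complex.normSq_nonneg (K j 0 1)
  have h10 := Complex.normSq_nonneg (K j 1 0)
  rw [← Complex.normSq_eq_zero]
  rcases bit_eq_zero_or_one a with rfl | rfl <;> rcases bit_eq_zero_or_one b with rfl | rfl
  · exact absurd rfl hab
  · linarith
  · linarith
  · exact absurd rfl hab

namespace IsPureZCoherent

variable {Φ : QubitMap}

theorem exists_diagonal_kraus (h : IsPureZCoherent Φ) :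
    ∃ (d : ℕ) (k : Fin d → Bit → ℂ), (∀ a, ∑ j, Complex.normSq (k j a) = 1) ∧
      ∀ ρ a b, Φ ρ a b = (∑ j, k j a * star (k j b)) * ρ a b := by
  obtain ⟨d, K, hK, hΦ⟩ := h.channel
  have hZ : ∑ j, (pauliZᴴ * (K j * pauliZ * (K j)ᴴ)).trace = 2 := by
    rw [← Matrix.trace_sum, ← Matrix.mul_sum, ← hΦ, ← div_eq_one_iff_eq two_ne_zero]
    exact h.zz
  obtain ⟨k, hk⟩ : ∃ k : Fin d → Bit → ℂ, ∀ j, K j = Matrix.diagonal (k j) := by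
    refine ⟨fun j a => K j a a, fun j => ?_⟩
    ext a b
    rcases eq_or_ne a b with rfl | hab
    · simp
    · rw [Matrix.diagonal_apply_ne _ hab, kraus_apply_eq_zero_of_ne hK hZ j hab]
  refine ⟨d, k, fun a => ?_, fun ρ a b => ?_⟩
  · have h1 := congrFun₂ hK a a
    simp only [hk, Matrix.diagonal_conjTranspose, Matrix.diagonal_mul_diagonal, Matrix.sum_apply,
      Matrix.diagonal_apply_eq, Pi.star_apply, Complex.star_def,
      ← Complex.normSq_eq_conj_mul_self, Matrix.one_apply_eq] at h1
    exact_mod_cast h1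
  · rw [hΦ, Matrix.sum_apply, Finset.sum_mul]
    exact Finset.sum_congr rfl fun j _ => by rw [hk j]; exact conjBy_diagonal_apply (k j) ρ a b

theorem isSchur (h : IsPureZCoherent Φ) : IsSchur Φ := by
  obtain ⟨d, k, -, hΦ⟩ := h.exists_diagonal_kraus
  exact isSchur_of_forall hΦ

theorem schurCoeff_self (h : IsPureZCoherent Φ) (a : Bit) : schurCoeff Φ a a = 1 := by
  obtain ⟨d, k, hk, hΦ⟩ := h.exists_diagonal_kraus
  rw [schurCoeff_eq hΦ, ← Complex.ofReal_one, ← hk a, Complex.ofReal_sum]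
  exact Finset.sum_congr rfl fun j _ => Complex.mul_conj _

theorem schurCoeff_symm (h : IsPureZCoherent Φ) (a b : Bit) :
    schurCoeff Φ b a = star (schurCoeff Φ a b) := by
  obtain ⟨d, k, -, hΦ⟩ := h.exists_diagonal_kraus
  simp only [schurCoeff_eq hΦ, star_sum, star_mul', star_star]
  exact Finset.sum_congr rfl fun j _ => mul_comm _ _

theorem norm_schurCoeff_le (h : IsPureZCoherent Φ) (a b : Bit) : ‖schurCoeff Φ a b‖ ≤ 1 := by
  obtain ⟨d, k, hk, hΦ⟩ := h.exists_diagonal_kraus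
  rw [schurCoeff_eq hΦ]
  calc ‖∑ j, k j a * star (k j b)‖
      ≤ ∑ j, (Complex.normSq (k j a) + Complex.normSq (k j b)) / 2 := by
        refine norm_sum_le_of_le _ fun j _ => ?_
        rw [norm_mul, norm_star, Complex.normSq_eq_norm_sq, Complex.normSq_eq_norm_sq]
        linarith [two_mul_le_add_sq ‖k j a‖ ‖k j b‖]
    _ = 1 := by rw [← Finset.sum_div, Finset.sum_add_distrib, hk, hk]; norm_num

end IsPureZCoherent

theorem IsSchur.zWeight_eq {Φ : QubitMap} (h : IsSchur Φ) :
    zWeight Φ = ((schurCoeff Φ 0 0 + schurCoeff Φ 1 1 -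
      (schurCoeff Φ 0 1 + schurCoeff Φ 1 0)) / 4).re := by
  have hptm : ∀ P P' : QubitOp, ptm Φ P P' =
      (∑ a, ∑ b, star (P b a) * (schurCoeff Φ b a * P' b a)) / 2 := fun P P' => by
    simp only [ptm, Matrix.trace, Matrix.diag_apply, Matrix.mul_apply, Matrix.conjTranspose_apply,
      h P']
  have h1 : ptm Φ 1 1 = (schurCoeff Φ 0 0 + schurCoeff Φ 1 1) / 2 := by
    simp [hptm, sum_bit, Matrix.one_apply]
  have hX : ptm Φ pauliX pauliX = (schurCoeff Φ 0 1 + schurCoeff Φ 1 0) / 2 := by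
    simp [hptm, sum_bit, pauliX_apply, CharTwo.add_self_eq_zero, add_comm]
  have hY : ptm Φ pauliY pauliY = (schurCoeff Φ 0 1 + schurCoeff Φ 1 0) / 2 := by
    simp [hptm, sum_bit, pauliY_apply, CharTwo.add_self_eq_zero, mul_comm _ Complex.I, ← mul_assoc,
      add_comm]
  have hZ : ptm Φ pauliZ pauliZ = (schurCoeff Φ 0 0 + schurCoeff Φ 1 1) / 2 := by
    simp [hptm, sum_bit, pauliZ_apply]
  rw [zWeight, h1, hX, hY, hZ]
  congr 1
  ring

/-! ### Splitting a real number into equal factors -/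

theorem prod_splitRoot (x : ℝ) {W : ℕ} (hW : W ≠ 0) :
    ∏ w ∈ Finset.range W, splitRoot x W w = x := by
  have hroot : ∀ y : ℝ, 0 ≤ y → (y ^ (1 / W : ℝ)) ^ W = y := fun y hy => by
    rw [one_div, Real.rpow_inv_natCast_pow hy hW]
  rcases le_or_gt 0 x with hx | hx
  · simp only [splitRoot, hx, if_true, Finset.prod_const, Finset.card_range, hroot]
  have hx' : 0 ≤ -x := by linarith
  simp only [splitRoot, hx.not_ge, if_false]
  rcases Nat.even_or_odd W with hW' | hW'
  · obtain ⟨W, rfl⟩ := Nat.exists_eq_succ_of_ne_zero hW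
    rw [Finset.prod_range_succ']
    simp only [Nat.not_odd_iff_even.mpr hW', false_or, Nat.succ_ne_zero, if_false, if_true,
      Finset.prod_const, Finset.card_range, mul_neg]
    rw [← pow_succ, hroot _ hx', neg_neg]
  · simp only [hW', true_or, if_true, Finset.prod_const, Finset.card_range, hW'.neg_pow,
      hroot _ hx', neg_neg]

theorem abs_splitRoot_le {x : ℝ} (hx : |x| ≤ 1) (W w : ℕ) : |splitRoot x W w| ≤ 1 := by
  have hroot : ∀ y : ℝ, 0 ≤ y → y ≤ 1 → |y ^ (1 / W : ℝ)| ≤ 1 := fun y h0 h1 => by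
    rw [abs_of_nonneg (Real.rpow_nonneg h0 _)]
    exact Real.rpow_le_one h0 h1 (by positivity)
  obtain ⟨hlow, hhigh⟩ := abs_le.mp hx
  unfold splitRoot
  split_ifs with h0
  · exact hroot x h0 hhigh
  · rw [abs_neg]; exact hroot _ (by linarith) (by linarith)
  · exact hroot _ (by linarith) (by linarith)

/-! ### Circuits of diagonal instructions -/

/-- The factor by which a diagonal instruction multiplies the entry `(z, z')`. -/
def Instr.factor {Q : Type} (z z' : Q → Bit) : Instr Q → ℂ
  | .cz a b => sgn (z a * z b) * sgn (z' a * z' b)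
  | .noise q Φ => schurCoeff Φ (z q) (z' q)

theorem Instr.factor_cz {Q : Type} (z z' : Q → Bit) (a b : Q) :
    (Instr.cz a b).factor z z' = sgn (z a * z b) * sgn (z' a * z' b) := rfl

theorem Instr.factor_noise {Q : Type} (z z' : Q → Bit) (q : Q) (Φ : QubitMap) :
    (Instr.noise q Φ).factor z z' = schurCoeff Φ (z q) (z' q) := rfl

/-- The instruction is a CZ gate or noise acting as a Schur multiplier. -/
def Instr.IsDiagonal {Q : Type} : Instr Q → Prop
  | .cz _ _ => True
  | .noise _ Φ => IsSchur Φ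

theorem Instr.IsDiagonal.apply_apply {Q : Type} [Fintype Q] [DecidableEq Q] {g : Instr Q}
    (hg : g.IsDiagonal) (ρ : Op Q) (z z' : Q → Bit) :
    g.apply ρ z z' = g.factor z z' * ρ z z' := by
  cases g with
  | cz a b => simp [Instr.apply, czGate, conjBy_diagonal_apply, Instr.factor]
  | noise q Φ =>
    have hΦ : IsSchur Φ := hg
    simp only [Instr.apply, applyAt, Instr.factor, Matrix.of_apply]
    rw [hΦ, Matrix.of_apply, Function.update_eq_self, Function.update_eq_self]

theorem runInstrs_apply {Q : Type} [Fintype Q] [DecidableEq Q] (c : List (Instr Q))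
    (hc : ∀ g ∈ c, g.IsDiagonal) (ρ : Op Q) (z z' : Q → Bit) :
    runInstrs c ρ z z' = (c.map fun g => g.factor z z').prod * ρ z z' := by
  induction c generalizing ρ with
  | nil => simp [runInstrs]
  | cons g c ih =>
    have hcons : runInstrs (g :: c) ρ = runInstrs c (g.apply ρ) := rfl
    rw [hcons, ih (fun g' hg' => hc g' (List.mem_cons_of_mem _ hg')),
      (hc g List.mem_cons_self).apply_apply, List.map_cons, List.prod_cons]
    ring

namespace CSSCode

variable {n : ℕ} {C : CSSCode n} {L : ℕ}

/-! ### The instructions of one step -/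

/-- The check matrix of the stabilizers of kind `κ`: its rows are the indicators of the supports. -/
def checkMatrix (C : CSSCode n) (κ : Kind) : Matrix (Fin (C.num κ)) (Fin n) Bit :=
  Matrix.of fun p i => if i ∈ C.supp κ p then 1 else 0

theorem checkMatrix_mulVec_apply (κ : Kind) (y : Fin n → Bit) (p : Fin (C.num κ)) :
    (C.checkMatrix κ *ᵥ y) p = ∑ i ∈ C.supp κ p, y i := by
  simp [Matrix.mulVec, dotProduct, checkMatrix]

theorem sgn_dotProduct_checkMatrix (κ : Kind) (a : Fin (C.num κ) → Bit) (y : Fin n → Bit) :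
    sgn (a ⬝ᵥ C.checkMatrix κ *ᵥ y) = ∏ p, ∏ i ∈ C.supp κ p, sgn (a p * y i) := by
  simp only [sgn_dotProduct, checkMatrix_mulVec_apply, Finset.mul_sum, sgn_sum]

/-- The number of stabilizers of kind `κ` that act on qubit `i`. -/
def degree (C : CSSCode n) (κ : Kind) (i : Fin n) : ℕ :=
  (Finset.univ.filter fun p => i ∈ C.supp κ p).card

theorem Schedule.toFinset_gates (sch : C.Schedule L) (r : Fin L) (κ : Kind) :
    (sch.gates r κ).toFinset = Finset.univ.filter fun g => g.2 ∈ C.supp κ g.1 := by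
  ext ⟨p, i⟩
  simp [sch.mem_iff]

theorem Schedule.countP_fst (sch : C.Schedule L) (r : Fin L) (κ : Kind) (p : Fin (C.num κ)) :
    (sch.gates r κ).countP (fun g => g.1 = p) = (C.supp κ p).card := by
  rw [← Finset.card_map (Function.Embedding.sectR p (Fin n))]
  simp only [← (sch.nodup r κ).card_eq_countP, toFinset_gates]
  congr 1
  ext ⟨q, i⟩
  aesop

theorem Schedule.countP_snd (sch : C.Schedule L) (r : Fin L) (κ : Kind) (i : Fin n) :
    (sch.gates r κ).countP (fun g => g.2 = i) = C.degree κ i := by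
  rw [degree, ← Finset.card_map (Function.Embedding.sectL _ i)]
  simp only [← (sch.nodup r κ).card_eq_countP, toFinset_gates]
  congr 1
  ext ⟨p, j⟩
  aesop

theorem Schedule.prod_gates {M : Type*} [CommMonoid M] (sch : C.Schedule L) (r : Fin L) (κ : Kind)
    (f : Fin (C.num κ) × Fin n → M) :
    ((sch.gates r κ).map f).prod = ∏ p, ∏ i ∈ C.supp κ p, f (p, i) := by
  simp only [← List.prod_toFinset f (sch.nodup r κ), toFinset_gates, Finset.prod_filter,
    Fintype.prod_prod_type, Finset.prod_ite_mem, Finset.univ_inter]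

/-- All noise maps that occur in the circuit are Schur multipliers. -/
def IsSchurNoise (N : C.Noise L) : Prop := ∀ γ, ∀ w < C.numLoc γ, IsSchur (N γ w)

theorem prod_prod_range_ite {ι M : Type*} [Fintype ι] [DecidableEq ι] [CommMonoid M] (j : ι)
    (k : ι → ℕ) (x : ι → ℕ → M) :
    (∏ i, ∏ w ∈ Finset.range (k i + if j = i then 1 else 0), x i w) =
      (∏ i, ∏ w ∈ Finset.range (k i), x i w) * x j (k j) := by
  have h : ∀ i, (∏ w ∈ Finset.range (k i + if j = i then 1 else 0), x i w) =
      (∏ w ∈ Finset.range (k i), x i w) * if j = i then x i (k i) else 1 := fun i => by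
    split_ifs <;> simp [Finset.prod_range_succ]
  simp only [h, Finset.prod_mul_distrib, Finset.prod_ite_eq, Finset.mem_univ, if_true]

-- Both sides are multiplied by the factors of the gates already done, so that the induction on
theorem prod_factor_checkInstrs (N : C.Noise L) (r : Fin L) (κ : Kind)
    (z z' : C.Reg κ → Bit) (done todo : List (Fin (C.num κ) × Fin n)) :
    ((checkInstrs N r κ done todo).map fun g => g.factor z z').prod *
      ((∏ p, ∏ w ∈ Finset.range (done.countP fun g => g.1 = p),
          schurCoeff (N (.inr (r, ⟨κ, p⟩)) (1 + w)) (z (.inr (.inr p))) (z' (.inr (.inr p)))) *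
        ∏ i, ∏ w ∈ Finset.range (done.countP fun g => g.2 = i),
          schurCoeff (N (.inl (r, κ, i)) (2 + w)) (z (.inr (.inl i))) (z' (.inr (.inl i)))) =
    (todo.map fun g => sgn (z (.inr (.inr g.1)) * z (.inr (.inl g.2))) *
        sgn (z' (.inr (.inr g.1)) * z' (.inr (.inl g.2)))).prod *
      ((∏ p, ∏ w ∈ Finset.range ((done.countP fun g => g.1 = p) + todo.countP fun g => g.1 = p),
          schurCoeff (N (.inr (r, ⟨κ, p⟩)) (1 + w)) (z (.inr (.inr p))) (z' (.inr (.inr p)))) *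
        ∏ i, ∏ w ∈ Finset.range ((done.countP fun g => g.2 = i) + todo.countP fun g => g.2 = i),
          schurCoeff (N (.inl (r, κ, i)) (2 + w)) (z (.inr (.inl i))) (z' (.inr (.inl i)))) := by
  induction todo generalizing done with
  | nil => simp [checkInstrs]
  | cons g todo ih =>
    obtain ⟨p, i⟩ := g
    have ih' := ih ((p, i) :: done)
    simp only [List.countP_cons, decide_eq_true_eq] at ih' ⊢
    rw [prod_prod_range_ite p _ fun p w =>
        schurCoeff (N (.inr (r, ⟨κ, p⟩)) (1 + w)) (z (.inr (.inr p))) (z' (.inr (.inr p))),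
      prod_prod_range_ite i _ fun i w =>
        schurCoeff (N (.inl (r, κ, i)) (2 + w)) (z (.inr (.inl i))) (z' (.inr (.inl i)))] at ih'
    simp only [checkInstrs, List.map_cons, List.prod_cons, Instr.factor_cz, Instr.factor_noise]
    simp only [add_comm (List.countP _ todo), ← add_assoc] at ih' ⊢
    linear_combination (sgn (z (.inr (.inr p)) * z (.inr (.inl i))) *
      sgn (z' (.inr (.inr p)) * z' (.inr (.inl i)))) * ih'

theorem isDiagonal_checkInstrs {N : C.Noise L} (hN : IsSchurNoise N) (r : Fin L) (κ : Kind)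
    (done todo : List (Fin (C.num κ) × Fin n))
    (hp : ∀ p, (done.countP fun g => g.1 = p) + (todo.countP fun g => g.1 = p) ≤
      (C.supp κ p).card)
    (hi : ∀ i, (done.countP fun g => g.2 = i) + (todo.countP fun g => g.2 = i) ≤ C.degree κ i) :
    ∀ g ∈ checkInstrs N r κ done todo, g.IsDiagonal := by
  induction todo generalizing done with
  | nil => simp [checkInstrs]
  | cons g todo ih =>
    obtain ⟨p, i⟩ := g
    have hp1 := hp p
    have hi1 := hi i
    simp only [List.countP_cons, decide_true, if_true] at hp1 hi1
    have hih := ih ((p, i) :: done)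
      (fun q => by have := hp q; simp only [List.countP_cons] at this ⊢; omega)
      (fun j => by have := hi j; simp only [List.countP_cons] at this ⊢; omega)
    simp only [checkInstrs, List.mem_cons]
    rintro g (rfl | rfl | rfl | hg)
    · trivial
    · exact hN _ _ (by simp only [numLoc]; omega)
    · exact hN _ _ (by simp only [numLoc]; unfold degree at hi1; omega)
    · exact hih g hg

theorem numLoc_ne_zero (γ : C.PhysQubit L) : C.numLoc γ ≠ 0 := by
  rcases γ with ⟨r, κ, i⟩ | ⟨r, κ, p⟩ <;> simp only [numLoc] <;> omega

theorem IsSchurNoise.lastNoise {N : C.Noise L} (hN : IsSchurNoise N) (r : Fin L) (κ : Kind)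
    (i : Fin n) : IsSchur (lastNoise N r κ i) := by
  cases κ with
  | Z => exact hN _ _ (Nat.sub_one_lt (numLoc_ne_zero _))
  | X =>
    simp only [CSSCode.lastNoise]
    split_ifs
    · exact hN _ _ (Nat.sub_one_lt (numLoc_ne_zero _))
    · exact isSchur_id

theorem isDiagonal_stepInstrs (sch : C.Schedule L) {N : C.Noise L} (hN : IsSchurNoise N)
    (r : Fin L) (κ : Kind) : ∀ g ∈ stepInstrs sch N r κ, g.IsDiagonal := by
  intro g hg
  simp only [stepInstrs, prepInstrs, teleInstrs, List.mem_append, List.mem_map, List.mem_flatMap,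
    List.mem_cons, List.not_mem_nil, or_false] at hg
  rcases hg with ((⟨i, -, rfl⟩ | ⟨p, -, rfl⟩) | ⟨i, -, rfl | rfl | rfl⟩) | hg
  · exact hN _ _ (by simp only [numLoc]; omega)
  · exact hN _ _ (by simp only [numLoc]; omega)
  · trivial
  · exact hN.lastNoise r κ i
  · exact hN _ _ (by simp only [numLoc]; omega)
  · exact isDiagonal_checkInstrs hN r κ [] _ (fun p => by simp [sch.countP_fst])
      (fun i => by simp [sch.countP_snd]) g hg

theorem prod_map_flatMap_finRange {M : Type*} [CommMonoid M] {α : Type*} (m : ℕ)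
    (f : Fin m → List α) (x : α → M) :
    (((List.finRange m).flatMap f).map x).prod = ∏ i, ((f i).map x).prod := by
  rw [List.map_flatMap, List.flatMap_def, List.prod_flatten, List.map_map, Fin.prod_univ_def]
  rfl

theorem prod_factor_stepInstrs (sch : C.Schedule L) (N : C.Noise L) (r : Fin L) (κ : Kind)
    (z z' y y' : Fin n → Bit) (a a' : Fin (C.num κ) → Bit) :
    ((stepInstrs sch N r κ).map fun g =>
        g.factor (Sum.elim z (Sum.elim y a)) (Sum.elim z' (Sum.elim y' a'))).prod =
      (sgn (z ⬝ᵥ y) * sgn (z' ⬝ᵥ y')) *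
      (∏ i, schurCoeff (lastNoise N r κ i) (z i) (z' i)) *
      (∏ i, ∏ w ∈ Finset.range (2 + C.degree κ i),
        schurCoeff (N (.inl (r, κ, i)) w) (y i) (y' i)) *
      (∏ p, ∏ w ∈ Finset.range (1 + (C.supp κ p).card),
        schurCoeff (N (.inr (r, ⟨κ, p⟩)) w) (a p) (a' p)) *
      (sgn (a ⬝ᵥ C.checkMatrix κ *ᵥ y) * sgn (a' ⬝ᵥ C.checkMatrix κ *ᵥ y')) := by
  have hcheck := prod_factor_checkInstrs N r κ (Sum.elim z (Sum.elim y a))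
    (Sum.elim z' (Sum.elim y' a')) [] (sch.gates r κ)
  simp only [List.countP_nil, Finset.range_zero, Finset.prod_empty, Finset.prod_const_one, mul_one,
    zero_add, sch.countP_fst, sch.countP_snd, sch.prod_gates, Sum.elim_inl, Sum.elim_inr] at hcheck
  rw [sgn_dotProduct_checkMatrix, sgn_dotProduct_checkMatrix, sgn_dotProduct z, sgn_dotProduct z']
  simp only [stepInstrs, List.map_append, List.prod_append, hcheck, prepInstrs, teleInstrs,
    prod_map_flatMap_finRange, List.map_map, ← Fin.prod_univ_def, Function.comp_def,
    Instr.factor_cz, Instr.factor_noise, Sum.elim_inl, Sum.elim_inr, List.map_cons,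
    List.map_nil, List.prod_cons, List.prod_nil, mul_one,
    Finset.prod_range_add, Finset.prod_mul_distrib, Finset.prod_range_succ, Finset.range_zero,
    Finset.prod_empty, one_mul]
  ring

end CSSCode

/-! ### The effect of one step -/

theorem sum_sum_elim {A F B M : Type} [Fintype A] [Fintype F] [Fintype B] [DecidableEq A]
    [DecidableEq F] [DecidableEq B] [AddCommMonoid M] (f : (A ⊕ (F ⊕ B) → Bit) → M) :
    ∑ z, f z = ∑ z : A → Bit, ∑ x : (F → Bit) × (B → Bit), f (Sum.elim z (Sum.elim x.1 x.2)) := by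
  rw [← (Equiv.sumArrowEquivProdArrow A (F ⊕ B) Bit).symm.sum_comp f, Fintype.sum_prod_type]
  refine Finset.sum_congr rfl fun z _ => ?_
  rw [← (Equiv.sumArrowEquivProdArrow F B Bit).symm.sum_comp]
  rfl

theorem measKraus_elim {A F B : Type} [Fintype A] [Fintype F] [Fintype B] (m : A → Bit)
    (s : B → Bit) (y u : F → Bit) (z : A → Bit) (a : B → Bit) :
    measKraus m s y (Sum.elim z (Sum.elim u a)) =
      if u = y then sgn (m ⬝ᵥ z) * sgn (s ⬝ᵥ a) / (√2 : ℂ) ^ (Fintype.card A + Fintype.card B)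
      else 0 := by
  have hprod : (∏ i, xBra (m i) (z i)) * ∏ p, xBra (s p) (a p) =
      sgn (m ⬝ᵥ z) * sgn (s ⬝ᵥ a) / (√2 : ℂ) ^ (Fintype.card A + Fintype.card B) := by
    simp only [xBra, Finset.prod_div_distrib, ← sgn_dotProduct, Finset.prod_const,
      Finset.card_univ, pow_add]
    ring
  rw [← hprod]
  rfl

/-- Entrywise multiplication by a product of single-qubit coefficients. -/
def schurBy {Q : Type*} [Fintype Q] (c : Q → Bit → Bit → ℂ) (ρ : Op Q) : Op Q :=
  Matrix.of fun z z' => (∏ i, c i (z i) (z' i)) * ρ z z'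

theorem schurBy_one {Q : Type*} [Fintype Q] (ρ : Op Q) : schurBy (fun _ _ _ => 1) ρ = ρ := by
  ext z z'
  simp [schurBy]

namespace CSSCode

variable {n : ℕ} {C : CSSCode n} {L : ℕ}

variable (C) in
/-- Bits on the code qubits and on the stabilizers of kind `κ`: the outcomes of a step, or the
computational basis states of its fresh qubits and ancillas. -/
abbrev StepBits (κ : Kind) := (Fin n → Bit) × (Fin (C.num κ) → Bit)

/-- The part of the Kraus operator of a step with outcomes `o` in which the fresh qubits and
ancillas are in the computational basis state `x`. -/
def stepKraus (κ : Kind) (o x : C.StepBits κ) : Op (Fin n) :=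
  Matrix.of fun y z => if x.1 = y then
    (1 / 2) ^ (n + C.num κ) * sgn (z ⬝ᵥ (o.1 + x.1) + x.2 ⬝ᵥ (o.2 + C.checkMatrix κ *ᵥ x.1))
  else 0

/-- The contribution to the effect of a step of the pair of basis states `x`, `x'`. -/
def pathStep (κ : Kind) (o x x' : C.StepBits κ) : Op (Fin n) →ₗ[ℂ] Op (Fin n) :=
  LinearMap.mulRight ℂ (stepKraus κ o x')ᴴ ∘ₗ LinearMap.mulLeft ℂ (stepKraus κ o x)

theorem pathStep_apply (κ : Kind) (o x x' : C.StepBits κ) (ρ : Op (Fin n)) :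
    pathStep κ o x x' ρ = stepKraus κ o x * ρ * (stepKraus κ o x')ᴴ := rfl

/-- The effect of a step in which all noise of the fresh qubits and ancillas acts at once, with
coefficients `cF` and `cA`. -/
def lumpedStep (κ : Kind) (cF : Fin n → Bit → Bit → ℂ) (cA : Fin (C.num κ) → Bit → Bit → ℂ)
    (o : C.StepBits κ) (ρ : Op (Fin n)) : Op (Fin n) :=
  ∑ x : C.StepBits κ × C.StepBits κ,
    ((∏ i, cF i (x.1.1 i) (x.2.1 i)) * ∏ p, cA p (x.1.2 p) (x.2.2 p)) • pathStep κ o x.1 x.2 ρ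

theorem stepKraus_apply (κ : Kind) (o x : C.StepBits κ) (y z : Fin n → Bit) :
    stepKraus κ o x y z = measKraus o.1 o.2 y (Sum.elim z (Sum.elim x.1 x.2)) *
      (sgn (z ⬝ᵥ x.1) * sgn (x.2 ⬝ᵥ C.checkMatrix κ *ᵥ x.1) / (√2 : ℂ) ^ (n + C.num κ)) := by
  have hsqrt : (√2 : ℂ) * √2 = 2 := by
    rw [← Complex.ofReal_mul, Real.mul_self_sqrt zero_le_two, Complex.ofReal_ofNat]
  simp only [stepKraus, Matrix.of_apply, measKraus_elim, Fintype.card_fin]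
  split_ifs
  · rw [dotProduct_comm o.1, dotProduct_comm o.2, dotProduct_add, dotProduct_add, sgn_add, sgn_add,
      sgn_add, ← hsqrt, div_pow, one_pow, mul_pow]
    ring
  · rw [zero_mul]

theorem attachPlus_elim {A F B : Type} [Fintype F] [Fintype B] (ρ : Op A) (z z' : A → Bit)
    (x x' : F ⊕ B → Bit) :
    attachPlus ρ (Sum.elim z x) (Sum.elim z' x') =
      ρ z z' * (1 / 2) ^ (Fintype.card F + Fintype.card B) := by
  simp [attachPlus, tensor]

theorem step_eq_lumpedStep (sch : C.Schedule L) {N : C.Noise L} (hN : IsSchurNoise N) (r : Fin L)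
    (κ : Kind) (o : C.StepBits κ) (ρ : Op (Fin n)) :
    step sch N r κ o.1 o.2 ρ =
      lumpedStep κ
        (fun i a b => ∏ w ∈ Finset.range (2 + C.degree κ i),
          schurCoeff (N (.inl (r, κ, i)) w) a b)
        (fun p a b => ∏ w ∈ Finset.range (1 + (C.supp κ p).card),
          schurCoeff (N (.inr (r, ⟨κ, p⟩)) w) a b)
        o (schurBy (fun i => schurCoeff (lastNoise N r κ i)) ρ) := by
  have hsqrt : ((√2 : ℂ) ^ (n + C.num κ))⁻¹ * star ((√2 : ℂ) ^ (n + C.num κ))⁻¹ =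
      (1 / 2) ^ (n + C.num κ) := by
    rw [star_inv₀, star_pow, Complex.star_def, Complex.conj_ofReal, ← mul_inv, ← mul_pow,
      ← Complex.ofReal_mul, Real.mul_self_sqrt zero_le_two, Complex.ofReal_ofNat, one_div, inv_pow]
  ext y y'
  rw [lumpedStep, Fintype.sum_prod_type_right]
  simp only [pathStep_apply, step, conjBy, LinearMap.coe_mk,
    AddHom.coe_mk, Matrix.sum_apply, Matrix.smul_apply, Matrix.mul_apply, sum_sum_elim,
    Matrix.conjTranspose_apply, Finset.sum_mul, smul_eq_mul, Finset.mul_sum]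
  rw [Finset.sum_comm]
  refine Finset.sum_congr rfl fun x' _ => ?_
  rw [Finset.sum_comm (s := (Finset.univ : Finset (C.StepBits κ)))]
  refine Finset.sum_congr rfl fun z' _ => ?_
  rw [Finset.sum_comm]
  refine Finset.sum_congr rfl fun x _ => Finset.sum_congr rfl fun z _ => ?_
  rw [runInstrs_apply _ (isDiagonal_stepInstrs sch hN r κ), prod_factor_stepInstrs,
    attachPlus_elim, stepKraus_apply, stepKraus_apply, Fintype.card_fin, Fintype.card_fin, ← hsqrt]
  simp only [schurBy, Matrix.of_apply, star_mul', star_div₀, star_sgn, star_inv₀]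
  ring

theorem schurBy_lumpedStep (κ : Kind) (d cF : Fin n → Bit → Bit → ℂ)
    (cA : Fin (C.num κ) → Bit → Bit → ℂ) (o : C.StepBits κ) (ρ : Op (Fin n)) :
    schurBy d (lumpedStep κ cF cA o ρ) = lumpedStep κ (fun i a b => d i a b * cF i a b) cA o ρ := by
  ext y y'
  simp only [schurBy, lumpedStep, Matrix.of_apply, Matrix.sum_apply, Matrix.smul_apply,
    smul_eq_mul, Finset.mul_sum, Finset.prod_mul_distrib]
  refine Finset.sum_congr rfl fun x _ => ?_
  by_cases hy : x.1.1 = y ∧ x.2.1 = y'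
  · rw [hy.1, hy.2]
    ring
  · have hzero : pathStep κ o x.1 x.2 ρ y y' = 0 := by
      rcases not_and_or.mp hy with hy | hy <;>
        simp [pathStep_apply, Matrix.mul_apply, Matrix.conjTranspose_apply, stepKraus, hy]
    simp only [hzero, mul_zero]

/-! ### Lumping the noise of each physical qubit -/

/-- The product of the coefficients of all noise locations on a physical qubit. -/
def totalCoeff (N : C.Noise L) (γ : C.PhysQubit L) (a b : Bit) : ℂ :=
  ∏ w ∈ Finset.range (C.numLoc γ), schurCoeff (N γ w) a b

/-- A round of the circuit in which each physical qubit suffers the noise `c` at once. -/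
def lumpedRound (c : C.PhysQubit L → Bit → Bit → ℂ) (o : C.Outcome L) (ρ : Op (Fin n))
    (r : Fin L) : Op (Fin n) :=
  lumpedStep .Z (fun i => c (.inl (r, .Z, i))) (fun p => c (.inr (r, ⟨.Z, p⟩))) (o r .Z)
    (lumpedStep .X (fun i => c (.inl (r, .X, i))) (fun p => c (.inr (r, ⟨.X, p⟩))) (o r .X) ρ)

/-- The noise that the code qubits still have to suffer after `r` rounds. -/
def pendingCoeff (N : C.Noise L) (r : ℕ) (i : Fin n) : Bit → Bit → ℂ :=
  if h : r < L then schurCoeff (lastNoise N ⟨r, h⟩ .X i) else fun _ _ => 1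

theorem pendingCoeff_zero (N : C.Noise L) : pendingCoeff N 0 = fun _ _ _ => 1 := by
  funext i a b
  unfold pendingCoeff
  split_ifs <;> simp [lastNoise]

theorem pendingCoeff_val (N : C.Noise L) (r : Fin L) :
    pendingCoeff N r = fun i => schurCoeff (lastNoise N r .X i) := by
  funext i
  simp [pendingCoeff]

theorem pendingCoeff_length (N : C.Noise L) : pendingCoeff N L = fun _ _ _ => 1 := by
  funext i
  simp [pendingCoeff]

theorem lastNoise_mul_prod_eq_totalCoeff (N : C.Noise L) (r : Fin L) (i : Fin n) (a b : Bit) :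
    schurCoeff (lastNoise N r .Z i) a b *
      ∏ w ∈ Finset.range (2 + C.degree .X i), schurCoeff (N (.inl (r, .X, i)) w) a b =
    totalCoeff N (.inl (r, .X, i)) a b := by
  have hnum : C.numLoc (L := L) (.inl (r, .X, i)) = 2 + C.degree .X i + 1 := by
    simp [numLoc, degree]
  rw [totalCoeff, hnum, Finset.prod_range_succ, mul_comm]
  simp [lastNoise, hnum]

theorem pendingCoeff_mul_prod_eq_totalCoeff (N : C.Noise L) (r : Fin L) (i : Fin n) (a b : Bit) :
    pendingCoeff N (r + 1) i a b *
      ∏ w ∈ Finset.range (2 + C.degree .Z i), schurCoeff (N (.inl (r, .Z, i)) w) a b =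
    totalCoeff N (.inl (r, .Z, i)) a b := by
  unfold pendingCoeff totalCoeff
  split_ifs with h
  · have hnum : C.numLoc (L := L) (.inl (r, .Z, i)) = 2 + C.degree .Z i + 1 := by
      simp [numLoc, degree, h.ne]
    rw [hnum, Finset.prod_range_succ, mul_comm]
    simp [lastNoise, hnum]
  · have hnum : C.numLoc (L := L) (.inl (r, .Z, i)) = 2 + C.degree .Z i := by
      simp [numLoc, degree, le_antisymm r.isLt (not_lt.mp h)]
    rw [hnum, one_mul]

end CSSCode

theorem foldl_finRange_induction {α β : Type*} {L : ℕ} (f : α → Fin L → α) (g : β → Fin L → β)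
    (P : ℕ → α → β → Prop) {x : α} {y : β} (zero : P 0 x y)
    (succ : ∀ (r : Fin L) (x : α) (y : β), P r x y → P (r + 1) (f x r) (g y r)) :
    P L ((List.finRange L).foldl f x) ((List.finRange L).foldl g y) := by
  induction L with
  | zero => simpa using zero
  | succ L ih =>
    rw [List.finRange_succ_last, List.foldl_append, List.foldl_append, List.foldl_map,
      List.foldl_map]
    exact succ (Fin.last L) _ _
      (ih (fun x r => f x r.castSucc) (fun y r => g y r.castSucc)
        fun r x y h => succ r.castSucc x y h)

namespace CSSCode

variable {n : ℕ} {C : CSSCode n} {L : ℕ}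

-- Noise acting between the CZ gates of a step commutes with them, and noise on a fresh qubit after
-- its teleportation CZ of the next step can be moved back to the end of its own step.
theorem branch_eq_foldl_lumpedRound (sch : C.Schedule L) {N : C.Noise L} (hN : IsSchurNoise N)
    (o : C.Outcome L) (ρ : Op (Fin n)) :
    branch sch N o ρ = (List.finRange L).foldl (lumpedRound (totalCoeff N) o) ρ := by
  have key := foldl_finRange_induction
    (fun ρ r => step sch N r .Z (o r .Z).1 (o r .Z).2 (step sch N r .X (o r .X).1 (o r .X).2 ρ))
    (lumpedRound (totalCoeff N) o) (fun r x y => schurBy (pendingCoeff N r) x = y)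
    (x := ρ) (y := ρ) (by rw [pendingCoeff_zero, schurBy_one]) fun r x y h => ?_
  · rwa [pendingCoeff_length, schurBy_one] at key
  · rw [step_eq_lumpedStep sch hN, step_eq_lumpedStep sch hN, schurBy_lumpedStep,
      schurBy_lumpedStep, ← pendingCoeff_val, h]
    simp only [pendingCoeff_mul_prod_eq_totalCoeff, lastNoise_mul_prod_eq_totalCoeff]
    rfl

end CSSCode

/-! ### Expansion in pairs of computational paths -/

theorem foldl_finRange_sum {J M R : Type*} [Fintype J] [CommSemiring R] [AddCommMonoid M]
    [Module R M] {L : ℕ} (w : Fin L → J → R) (Φ : Fin L → J → M →ₗ[R] M) (x : M) :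
    (List.finRange L).foldl (fun x r => ∑ j, w r j • Φ r j x) x =
      ∑ j : Fin L → J, (∏ r, w r (j r)) • (List.finRange L).foldl (fun x r => Φ r (j r) x) x := by
  induction L with
  | zero => simp
  | succ L ih =>
    have hcastSucc := ih (fun r => w r.castSucc) (fun r => Φ r.castSucc)
    rw [List.finRange_succ_last, List.foldl_append, List.foldl_map, hcastSucc,
      ← (Fin.snocEquiv fun _ => J).sum_comp, Fintype.sum_prod_type]
    simp only [List.foldl_cons, List.foldl_nil, map_sum, map_smul, Finset.smul_sum]
    refine Finset.sum_congr rfl fun j _ => Finset.sum_congr rfl fun i _ => ?_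
    rw [Fin.prod_univ_castSucc, List.foldl_append, List.foldl_map, smul_smul, mul_comm]
    simp [Fin.snocEquiv]

theorem prod_kind {M : Type*} [CommMonoid M] (f : Kind → M) : ∏ κ, f κ = f .X * f .Z := by
  have huniv : (Finset.univ : Finset Kind) = {Kind.X, Kind.Z} := rfl
  rw [huniv, Finset.prod_pair (by decide)]

/-- A family indexed by the two kinds is a pair. -/
def piKindEquiv (T : Kind → Type*) : (∀ κ, T κ) ≃ T .X × T .Z where
  toFun E := (E .X, E .Z)
  invFun x
    | .X => x.1
    | .Z => x.2
  left_inv E := by funext κ; cases κ <;> rfl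
  right_inv _ := rfl

theorem sum_piKind {M : Type*} [AddCommMonoid M] {T : Kind → Type*} [∀ κ, Fintype (T κ)]
    (f : T .X → T .Z → M) : ∑ E : (κ : Kind) → T κ, f (E .X) (E .Z) = ∑ x, ∑ y, f x y := by
  rw [← Fintype.sum_prod_type', ← (piKindEquiv T).sum_comp]
  rfl

namespace CSSCode

variable {n : ℕ} {C : CSSCode n} {L : ℕ}

variable (C L) in
/-- An element of `C.Outcome L` also records a computational path, that is, a basis state of every
physical qubit. -/
def physBits : C.Outcome L ≃ (C.PhysQubit L → Bit) where
  toFun x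
    | .inl (r, κ, i) => (x r κ).1 i
    | .inr (r, ⟨κ, p⟩) => (x r κ).2 p
  invFun b r κ := (fun i => b (.inl (r, κ, i)), fun p => b (.inr (r, ⟨κ, p⟩)))
  left_inv _ := rfl
  right_inv b := by funext γ; rcases γ with _ | _ <;> rfl

theorem physBits_add (x d : C.Outcome L) :
    physBits C L (x + d) = physBits C L x + physBits C L d := by
  funext γ
  rcases γ with _ | _ <;> rfl

theorem prod_physQubit {M : Type*} [CommMonoid M] (f : C.PhysQubit L → M) :
    ∏ γ, f γ = ∏ r, ∏ κ, ((∏ i, f (.inl (r, κ, i))) * ∏ p, f (.inr (r, ⟨κ, p⟩))) := by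
  simp only [Fintype.prod_sum_type, Fintype.prod_prod_type, Fintype.prod_sigma,
    Finset.prod_mul_distrib]

/-- The contribution to a branch of the pair of computational paths `x`, `x'`. -/
def pathBranch (o x x' : C.Outcome L) (ρ : Op (Fin n)) : Op (Fin n) :=
  (List.finRange L).foldl (fun ρ r => pathStep .Z (o r .Z) (x r .Z) (x' r .Z)
    (pathStep .X (o r .X) (x r .X) (x' r .X) ρ)) ρ

theorem foldl_lumpedRound (c : C.PhysQubit L → Bit → Bit → ℂ) (o : C.Outcome L) (ρ : Op (Fin n)) :
    (List.finRange L).foldl (lumpedRound c o) ρ =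
      ∑ x : C.Outcome L, ∑ x' : C.Outcome L,
        (∏ γ, c γ (physBits C L x γ) (physBits C L x' γ)) • pathBranch o x x' ρ := by
  have hround : lumpedRound c o = fun ρ r => ∑ E : ∀ κ, C.StepBits κ × C.StepBits κ,
      (∏ κ, ((∏ i, c (.inl (r, κ, i)) ((E κ).1.1 i) ((E κ).2.1 i)) *
        ∏ p, c (.inr (r, ⟨κ, p⟩)) ((E κ).1.2 p) ((E κ).2.2 p))) •
      (pathStep .Z (o r .Z) (E .Z).1 (E .Z).2 ∘ₗ pathStep .X (o r .X) (E .X).1 (E .X).2) ρ := by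
    funext ρ r
    simp only [prod_kind]
    rw [sum_piKind (T := fun κ => C.StepBits κ × C.StepBits κ) fun x y =>
      (((∏ i, c (.inl (r, .X, i)) (x.1.1 i) (x.2.1 i)) *
          ∏ p, c (.inr (r, ⟨.X, p⟩)) (x.1.2 p) (x.2.2 p)) *
        ((∏ i, c (.inl (r, .Z, i)) (y.1.1 i) (y.2.1 i)) *
          ∏ p, c (.inr (r, ⟨.Z, p⟩)) (y.1.2 p) (y.2.2 p))) •
        (pathStep .Z (o r .Z) y.1 y.2 ∘ₗ pathStep .X (o r .X) x.1 x.2) ρ, Finset.sum_comm]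
    simp only [lumpedRound, lumpedStep, map_sum, map_smul, Finset.smul_sum, smul_smul,
      LinearMap.comp_apply]
    refine Finset.sum_congr rfl fun y _ => Finset.sum_congr rfl fun x _ => ?_
    rw [mul_comm]
  let e : C.Outcome L × C.Outcome L ≃ (Fin L → ∀ κ, C.StepBits κ × C.StepBits κ) :=
    { toFun := fun x r κ => (x.1 r κ, x.2 r κ)
      invFun := fun E => (fun r κ => (E r κ).1, fun r κ => (E r κ).2)
      left_inv := fun _ => rfl
      right_inv := fun _ => rfl }
  rw [hround, foldl_finRange_sum, ← e.sum_comp, Fintype.sum_prod_type]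
  simp only [prod_physQubit]
  rfl

end CSSCode

/-! ### Pauli strings -/

theorem eq_add_iff_add_eq {G : Type*} [AddCommGroup G] [Module (ZMod 2) G] {y z a : G} :
    y = z + a ↔ y + a = z := by
  rw [← ZModModule.sub_eq_add y, sub_eq_iff_eq_add]

theorem conjBy_mul {α β γ : Type*} [Fintype α] [Fintype β] (A : Matrix γ β ℂ) (B : Matrix β α ℂ)
    (ρ : Matrix α α ℂ) : conjBy (A * B) ρ = conjBy A (conjBy B ρ) := by
  simp only [conjBy, LinearMap.coe_mk, AddHom.coe_mk, Matrix.conjTranspose_mul, Matrix.mul_assoc]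

theorem conjBy_sgn_smul {α β : Type*} [Fintype α] (b : Bit) (A : Matrix β α ℂ)
    (ρ : Matrix α α ℂ) : conjBy (sgn b • A) ρ = conjBy A ρ := by
  simp [conjBy, smul_smul]

section PauliString

variable {Q : Type*} [Fintype Q]

/-- The tensor product of the operators `X^{a_i} Z^{b_i}`. -/
def pauliString (a b : Q → Bit) : Op Q :=
  Matrix.of fun y z => if y = z + a then sgn (b ⬝ᵥ z) else 0

theorem pauliString_zero_zero : pauliString (0 : Q → Bit) 0 = 1 := by
  ext y z
  simp [pauliString, Matrix.one_apply]

theorem tensor_pauliX_pow_mul_pauliZ_pow (a b : Q → Bit) :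
    tensor (fun i => pauliX ^ (a i).val * pauliZ ^ (b i).val) = pauliString a b := by
  have hqubit : ∀ α β u v : Bit,
      (pauliX ^ α.val * pauliZ ^ β.val) u v = if u = v + α then sgn (β * v) else 0 := by
    intro α β u v
    rcases bit_eq_zero_or_one α with rfl | rfl <;> rcases bit_eq_zero_or_one β with rfl | rfl <;>
      simp [ZMod.val_one, pauliX_apply, pauliZ, Matrix.one_apply]
  ext y z
  simp only [tensor, pauliString, Matrix.of_apply, hqubit, Finset.prod_ite_zero, sgn_dotProduct,
    funext_iff, Pi.add_apply, Finset.mem_univ, true_imp_iff]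

variable [DecidableEq Q]

theorem pauliString_mul_apply {β : Type*} (a b : Q → Bit) (M : Matrix (Q → Bit) β ℂ)
    (y : Q → Bit) (w : β) :
    (pauliString a b * M) y w = sgn (b ⬝ᵥ (y + a)) * M (y + a) w := by
  simp [Matrix.mul_apply, pauliString, eq_add_iff_add_eq]

theorem mul_pauliString_apply {β : Type*} (a b : Q → Bit) (M : Matrix β (Q → Bit) ℂ) (y : β)
    (z : Q → Bit) : (M * pauliString a b) y z = M y (z + a) * sgn (b ⬝ᵥ z) := by
  simp [Matrix.mul_apply, pauliString]

theorem pauliString_mul_pauliString (a b a' b' : Q → Bit) :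
    pauliString a b * pauliString a' b' = sgn (b ⬝ᵥ a') • pauliString (a + a') (b + b') := by
  ext y z
  rw [mul_pauliString_apply]
  simp only [pauliString, Matrix.of_apply, Matrix.smul_apply, smul_eq_mul, dotProduct_add,
    add_dotProduct, sgn_add, add_comm a a', add_assoc]
  split_ifs <;> ring

theorem conjTranspose_pauliString_mul_self (a b : Q → Bit) :
    (pauliString a b)ᴴ * pauliString a b = 1 := by
  ext y z
  rw [mul_pauliString_apply, Matrix.conjTranspose_apply, pauliString, Matrix.of_apply]
  rcases eq_or_ne y z with rfl | h
  · simp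
  · simp [h, h.symm]

theorem conjBy_conjTranspose_pauliString_add (a b a' b' : Q → Bit) (ρ : Op Q) :
    conjBy (pauliString (a + a') (b + b'))ᴴ (conjBy (pauliString a' b') ρ) =
      conjBy (pauliString a b)ᴴ ρ := by
  have hsplit : pauliString (a + a') (b + b') =
      sgn (b' ⬝ᵥ a) • (pauliString a' b' * pauliString a b) := by
    rw [pauliString_mul_pauliString, smul_smul, sgn_mul_self, one_smul, add_comm a, add_comm b]
  rw [hsplit, Matrix.conjTranspose_smul, star_sgn, conjBy_sgn_smul, Matrix.conjTranspose_mul,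
    conjBy_mul, ← conjBy_mul (pauliString a' b')ᴴ, conjTranspose_pauliString_mul_self]
  simp [conjBy]

end PauliString

namespace CSSCode

variable {n : ℕ} {C : CSSCode n} {L : ℕ}

theorem frame_eq_pauliString (o : C.Outcome L) :
    frame o = pauliString (∑ r, (o r .Z).1) (∑ r, (o r .X).1) := by
  simp only [← tensor_pauliX_pow_mul_pauliZ_pow, Finset.sum_apply, frame]

theorem stab_X (p : Fin (C.num .X)) : C.stab .X p = pauliString (C.checkMatrix .X p) 0 := by
  rw [← tensor_pauliX_pow_mul_pauliZ_pow, stab]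
  congr 1
  funext i
  by_cases h : i ∈ C.supp .X p <;> simp [checkMatrix, h, Kind.pauli, ZMod.val_one]

theorem stab_Z (p : Fin (C.num .Z)) : C.stab .Z p = pauliString 0 (C.checkMatrix .Z p) := by
  rw [← tensor_pauliX_pow_mul_pauliZ_pow, stab]
  congr 1
  funext i
  by_cases h : i ∈ C.supp .Z p <;> simp [checkMatrix, h, Kind.pauli, ZMod.val_one]

theorem checkMatrix_mulVec_vecMul {κ κ' : Kind} (h : κ ≠ κ') (v : Fin (C.num κ') → Bit) :
    C.checkMatrix κ *ᵥ (v ᵥ* C.checkMatrix κ') = 0 := by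
  have heven : ∀ (p : Fin (C.num κ)) (q : Fin (C.num κ')),
      Even (C.supp κ' q ∩ C.supp κ p).card := by
    cases κ <;> cases κ' <;> try exact absurd rfl h
    · exact fun p q => Finset.inter_comm (C.supp .X p) _ ▸ C.even_inter p q
    · exact fun p q => C.even_inter q p
  have hmul : C.checkMatrix κ * (C.checkMatrix κ')ᵀ = 0 := by
    ext p q
    rw [Matrix.zero_apply, ← (heven p q).natCast_zmod_two]
    simp [Matrix.mul_apply, checkMatrix, ← ite_and, ← Finset.mem_inter]
  rw [← Matrix.mulVec_transpose, Matrix.mulVec_mulVec, hmul, Matrix.zero_mulVec]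

theorem vecMul_mul_eq_of_row_mul_eq {m l α β : Type*} [Fintype m] [Fintype α] [DecidableEq α]
    {P : (l → Bit) → Matrix α α ℂ} (hzero : P 0 = 1) (hadd : ∀ a b, P (a + b) = P a * P b)
    {H : Matrix m l Bit} {V : Matrix α β ℂ} (hrow : ∀ p, P (H p) * V = V) (v : m → Bit) :
    P (v ᵥ* H) * V = V := by
  rw [Matrix.vecMul_eq_sum]
  refine Finset.sum_induction _ (fun a => P a * V = V) (fun a b ha hb => ?_) ?_ fun p _ => ?_
  · rw [hadd, Matrix.mul_assoc, hb, ha]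
  · rw [hzero, Matrix.one_mul]
  · rcases bit_eq_zero_or_one (v p) with hv | hv
    · rw [hv, zero_smul, hzero, Matrix.one_mul]
    · rw [hv, one_smul, hrow]

theorem pauliString_vecMul_mul {β : Type*} {V : Matrix (Fin n → Bit) β ℂ}
    (hV : ∀ κ p, C.stab κ p * V = V) (v : Fin (C.num .X) → Bit) (v' : Fin (C.num .Z) → Bit) :
    pauliString (v ᵥ* C.checkMatrix .X) (v' ᵥ* C.checkMatrix .Z) * V = V := by
  have hX : pauliString (v ᵥ* C.checkMatrix .X) 0 * V = V :=
    vecMul_mul_eq_of_row_mul_eq (P := fun a => pauliString a 0) pauliString_zero_zero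
      (fun a b => by simp [pauliString_mul_pauliString]) (fun p => stab_X p ▸ hV .X p) v
  have hZ : pauliString 0 (v' ᵥ* C.checkMatrix .Z) * V = V :=
    vecMul_mul_eq_of_row_mul_eq (P := fun b => pauliString 0 b) pauliString_zero_zero
      (fun a b => by simp [pauliString_mul_pauliString]) (fun p => stab_Z p ▸ hV .Z p) v'
  have hsplit := pauliString_mul_pauliString (v ᵥ* C.checkMatrix .X) 0 0 (v' ᵥ* C.checkMatrix .Z)
  rw [zero_dotProduct, sgn_zero, one_smul, add_zero, zero_add] at hsplit
  rw [← hsplit, Matrix.mul_assoc, hZ, hX]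

end CSSCode

/-! ### The shift symmetry of the foliation circuit -/

namespace CSSCode

variable {n : ℕ} {C : CSSCode n} {L : ℕ}

theorem stepKraus_add_mul_pauliString (κ : Kind) (o x d : C.StepBits κ) (p q : Fin n → Bit) :
    stepKraus κ (o + (d.1 + q, C.checkMatrix κ *ᵥ d.1)) (x + d) * pauliString p q =
      sgn (p ⬝ᵥ (o.1 + q) + d.2 ⬝ᵥ o.2) •
        (pauliString d.1 (p + d.2 ᵥ* C.checkMatrix κ) * stepKraus κ o x) := by
  have hfresh : o.1 + (d.1 + q) + (x.1 + d.1) = o.1 + q + x.1 := by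
    rw [add_comm d.1, ← add_assoc o.1, add_add_add_comm, ZModModule.add_self, add_zero]
  have hcheck : o.2 + C.checkMatrix κ *ᵥ d.1 + C.checkMatrix κ *ᵥ (x.1 + d.1) =
      o.2 + C.checkMatrix κ *ᵥ x.1 := by
    rw [Matrix.mulVec_add, add_add_add_comm, ZModModule.add_self, add_zero]
  have hphase : ∀ z, (z + p) ⬝ᵥ (o.1 + q + x.1) +
      (x.2 + d.2) ⬝ᵥ (o.2 + C.checkMatrix κ *ᵥ x.1) + q ⬝ᵥ z =
      p ⬝ᵥ (o.1 + q) + d.2 ⬝ᵥ o.2 + (p + d.2 ᵥ* C.checkMatrix κ) ⬝ᵥ x.1 +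
        (z ⬝ᵥ (o.1 + x.1) + x.2 ⬝ᵥ (o.2 + C.checkMatrix κ *ᵥ x.1)) := fun z => by
    simp only [add_dotProduct, dotProduct_add, ← Matrix.dotProduct_mulVec, dotProduct_comm q z]
    linear_combination (z ⬝ᵥ q) * CharTwo.two_eq_zero (R := Bit)
  ext y z
  rw [mul_pauliString_apply, Matrix.smul_apply, pauliString_mul_apply]
  simp only [stepKraus, Matrix.of_apply, Prod.fst_add, Prod.snd_add, hfresh, hcheck,
    ← eq_add_iff_add_eq]
  split_ifs with hx
  · rw [← hx, smul_eq_mul, mul_assoc, ← sgn_add, hphase, sgn_add, sgn_add]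
    ring
  · simp

theorem pathStep_add_conjBy_pauliString (κ : Kind) (o x x' d : C.StepBits κ) (p q : Fin n → Bit)
    (ρ : Op (Fin n)) :
    pathStep κ (o + (d.1 + q, C.checkMatrix κ *ᵥ d.1)) (x + d) (x' + d)
        (conjBy (pauliString p q) ρ) =
      conjBy (pauliString d.1 (p + d.2 ᵥ* C.checkMatrix κ)) (pathStep κ o x x' ρ) := by
  have hsplit : ∀ (K K' P : Op (Fin n)), K * conjBy P ρ * K'ᴴ = K * P * ρ * (K' * P)ᴴ := by
    intro K K' P
    simp only [conjBy, LinearMap.coe_mk, AddHom.coe_mk, Matrix.conjTranspose_mul, Matrix.mul_assoc]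
  rw [pathStep_apply, pathStep_apply, hsplit, stepKraus_add_mul_pauliString,
    stepKraus_add_mul_pauliString, Matrix.conjTranspose_smul, star_sgn, Matrix.smul_mul,
    Matrix.smul_mul, Matrix.mul_smul, smul_smul, sgn_mul_self, one_smul]
  simp only [conjBy, LinearMap.coe_mk, AddHom.coe_mk, Matrix.conjTranspose_mul, Matrix.mul_assoc]

/-- The `X` part of the Pauli operator that a shift of the computational paths by `w` leaves on the
code qubits after `r` rounds, the circuit being entered with a stabilizer. -/
def shiftX (w : C.Outcome L) : ℕ → Fin n → Bit
  | 0 => (∑ r, (w r .X).2) ᵥ* C.checkMatrix .X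
  | r + 1 => if h : r < L then (w ⟨r, h⟩ .Z).1 else 0

/-- The `Z` part of the same Pauli operator. -/
def shiftZ (w : C.Outcome L) : ℕ → Fin n → Bit
  | 0 => (∑ r, (w r .Z).2) ᵥ* C.checkMatrix .Z
  | r + 1 => if h : r < L then (w ⟨r, h⟩ .X).1 + (w ⟨r, h⟩ .Z).2 ᵥ* C.checkMatrix .Z else 0

theorem shiftX_succ (w : C.Outcome L) (r : Fin L) : shiftX w (r + 1) = (w r .Z).1 := by
  simp [shiftX]

theorem shiftZ_succ (w : C.Outcome L) (r : Fin L) :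
    shiftZ w (r + 1) = (w r .X).1 + (w r .Z).2 ᵥ* C.checkMatrix .Z := by
  simp [shiftZ]

/-- The change of the outcomes that compensates a shift of the computational paths by `w`. -/
def outcomeShift (w : C.Outcome L) : C.Outcome L := fun r κ =>
  ((w r κ).1 + match κ with
    | .X => shiftZ w r
    | .Z => shiftX w r + (w r .X).2 ᵥ* C.checkMatrix .X,
   C.checkMatrix κ *ᵥ (w r κ).1)

theorem pathBranch_add_conjBy_pauliString (o x x' w : C.Outcome L) (ρ : Op (Fin n)) :
    pathBranch (o + outcomeShift w) (x + w) (x' + w)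
        (conjBy (pauliString (shiftX w 0) (shiftZ w 0)) ρ) =
      conjBy (pauliString (shiftX w L) (shiftZ w L)) (pathBranch o x x' ρ) := by
  refine foldl_finRange_induction _ _
    (fun r ρ ρ' => ρ = conjBy (pauliString (shiftX w r) (shiftZ w r)) ρ') rfl fun r ρ ρ' h => ?_
  have hX := pathStep_add_conjBy_pauliString .X (o r .X) (x r .X) (x' r .X) (w r .X)
    (shiftX w r) (shiftZ w r) ρ'
  have hZ := pathStep_add_conjBy_pauliString .Z (o r .Z) (x r .Z) (x' r .Z) (w r .Z)
    (w r .X).1 (shiftX w r + (w r .X).2 ᵥ* C.checkMatrix .X)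
    (pathStep .X (o r .X) (x r .X) (x' r .X) ρ')
  rw [shiftX_succ, shiftZ_succ, ← hZ, ← hX, h]
  rfl

theorem sum_eq_of_telescope {G : Type*} [AddCommGroup G] [Module (ZMod 2) G] (f : ℕ → G)
    (g : Fin L → G) (h0 : f 0 = ∑ r, g r) :
    ∑ r : Fin L, (f (r + 1) + f r + g r) = f L := by
  rw [Finset.sum_add_distrib, ← h0, Fin.sum_univ_eq_sum_range fun r => f (r + 1) + f r]
  simp only [← ZModModule.sub_eq_add (f (_ + 1))]
  rw [Finset.sum_range_sub, sub_add_cancel]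

theorem frame_add_outcomeShift (o w : C.Outcome L) :
    frame (o + outcomeShift w) =
      pauliString (∑ r, (o r .Z).1 + shiftX w L) (∑ r, (o r .X).1 + shiftZ w L) := by
  have hX : ∑ r, (outcomeShift w r .Z).1 = shiftX w L := by
    rw [← sum_eq_of_telescope (shiftX w) fun r => (w r .X).2 ᵥ* C.checkMatrix .X]
    · simp only [shiftX_succ, outcomeShift, add_assoc]
    · simp [shiftX, Matrix.sum_vecMul]
  have hZ : ∑ r, (outcomeShift w r .X).1 = shiftZ w L := by
    rw [← sum_eq_of_telescope (shiftZ w) fun r => (w r .Z).2 ᵥ* C.checkMatrix .Z]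
    · refine Finset.sum_congr rfl fun r _ => ?_
      rw [shiftZ_succ, outcomeShift, add_right_comm (_ + _), add_assoc (w r .X).1,
        ZModModule.add_self, add_zero]
    · simp [shiftZ, Matrix.sum_vecMul]
  simp only [frame_eq_pauliString, Pi.add_apply, Prod.fst_add, Finset.sum_add_distrib, hX, hZ]

theorem syndrome_add (o o' : C.Outcome L) : syndrome (o + o') = syndrome o + syndrome o' := by
  funext r κ p
  simp only [syndrome, Pi.add_apply, Prod.fst_add, Prod.snd_add, Finset.sum_add_distrib]
  split_ifs <;> ring

theorem checkMatrix_X_mulVec_shiftZ (w : C.Outcome L) (r : Fin L) :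
    C.checkMatrix .X *ᵥ shiftZ w r = if 0 < r.val then C.checkMatrix .X *ᵥ
      (w ⟨r.val - 1, lt_of_le_of_lt (Nat.sub_le _ _) r.isLt⟩ .X).1 else 0 := by
  obtain ⟨_ | r, hr⟩ := r
  · simp [shiftZ, checkMatrix_mulVec_vecMul]
  · simp [shiftZ, Nat.lt_of_succ_lt hr, Matrix.mulVec_add, checkMatrix_mulVec_vecMul]

theorem checkMatrix_Z_mulVec_shiftX (w : C.Outcome L) (r : Fin L) :
    C.checkMatrix .Z *ᵥ shiftX w r = if 0 < r.val then C.checkMatrix .Z *ᵥ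
      (w ⟨r.val - 1, lt_of_le_of_lt (Nat.sub_le _ _) r.isLt⟩ .Z).1 else 0 := by
  obtain ⟨_ | r, hr⟩ := r
  · simp [shiftX, checkMatrix_mulVec_vecMul]
  · simp [shiftX, Nat.lt_of_succ_lt hr]

theorem syndrome_outcomeShift (w : C.Outcome L) : syndrome (outcomeShift w) = 0 := by
  funext r κ p
  have h : C.checkMatrix κ *ᵥ (outcomeShift w r κ).1 = C.checkMatrix κ *ᵥ (w r κ).1 +
      if 0 < r.val then C.checkMatrix κ *ᵥ
        (w ⟨r.val - 1, lt_of_le_of_lt (Nat.sub_le _ _) r.isLt⟩ κ).1 else 0 := by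
    cases κ
    · rw [outcomeShift, Matrix.mulVec_add, checkMatrix_X_mulVec_shiftZ]
    · rw [outcomeShift, Matrix.mulVec_add, Matrix.mulVec_add, checkMatrix_Z_mulVec_shiftX,
        checkMatrix_mulVec_vecMul (by decide), add_zero]
  rw [syndrome, ← checkMatrix_mulVec_apply, h]
  split_ifs <;> simp [outcomeShift, CharTwo.add_self_eq_zero]

end CSSCode

/-! ### The logical channel as a sum over differences of paths -/

/-- The sum of `c` over the pairs of bits with difference `d`. -/
def diagSum (c : Bit → Bit → ℂ) (d : Bit) : ℂ := ∑ a, c a (a + d)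

theorem diagSum_of_eq {c : Bit → Bit → ℂ} {f : Bit → ℂ} (h : ∀ a b, c a b = f (a + b)) (d : Bit) :
    diagSum c d = 2 * f d := by
  simp only [diagSum, h, CharTwo.add_cancel_left, sum_bit]
  ring

theorem sum_sum_smul_eq_of_add_invariant {G R M : Type*} [Fintype G] [AddCommGroup G]
    [Semiring R] [AddCommMonoid M] [Module R M] (f : G → G → R) {T : G → G → M}
    (hT : ∀ x x' w, T (x + w) (x' + w) = T x x') :
    ∑ x, ∑ x', f x x' • T x x' = ∑ d, (∑ x, f x (x + d)) • T 0 d := by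
  have hdiff : ∀ x d, T x (x + d) = T 0 d := fun x d => by
    rw [← hT 0 d x, zero_add, add_comm]
  simp only [Finset.sum_smul]
  rw [Finset.sum_comm (γ := G) (f := fun d x => f x (x + d) • T 0 d)]
  refine Finset.sum_congr rfl fun x _ => ?_
  rw [← Equiv.sum_comp (Equiv.addLeft x)]
  simp only [Equiv.coe_addLeft, hdiff]

namespace CSSCode

variable {n k : ℕ} {C : CSSCode n} {L : ℕ}

/-- The contribution to the logical channel of the pair of computational paths `x`, `x'`. -/
def pathTerm (V : Matrix (Fin n → Bit) (Fin k → Bit) ℂ)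
    (R : C.Syndrome L → Op (Fin n) →ₗ[ℂ] Op (Fin k)) (ρ : Op (Fin k)) (x x' : C.Outcome L) :
    Op (Fin k) :=
  ∑ o, R (syndrome o) (conjBy (frame o)ᴴ (pathBranch o x x' (conjBy V ρ)))

theorem pathTerm_add {V : Matrix (Fin n → Bit) (Fin k → Bit) ℂ}
    (hV : ∀ κ p, C.stab κ p * V = V) (R : C.Syndrome L → Op (Fin n) →ₗ[ℂ] Op (Fin k))
    (ρ : Op (Fin k)) (x x' w : C.Outcome L) :
    pathTerm V R ρ (x + w) (x' + w) = pathTerm V R ρ x x' := by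
  have hcode : conjBy V ρ = conjBy (pauliString (shiftX w 0) (shiftZ w 0)) (conjBy V ρ) := by
    rw [← conjBy_mul, shiftX, shiftZ, pauliString_vecMul_mul hV]
  rw [pathTerm, ← Equiv.sum_comp (Equiv.addRight (outcomeShift w))]
  refine Finset.sum_congr rfl fun o _ => ?_
  rw [Equiv.coe_addRight, syndrome_add, syndrome_outcomeShift, add_zero, frame_add_outcomeShift,
    hcode, pathBranch_add_conjBy_pauliString, conjBy_conjTranspose_pauliString_add,
    ← frame_eq_pauliString, ← hcode]

theorem sum_prod_physBits (c : C.PhysQubit L → Bit → Bit → ℂ) (d : C.Outcome L) :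
    ∑ x : C.Outcome L, ∏ γ, c γ (physBits C L x γ) (physBits C L (x + d) γ) =
      ∏ γ, diagSum (c γ) (physBits C L d γ) := by
  simp only [diagSum, Fintype.prod_sum, ← (physBits C L).sum_comp, physBits_add, Pi.add_apply]

theorem logicalChannel_eq_sum (sch : C.Schedule L) {V : Matrix (Fin n → Bit) (Fin k → Bit) ℂ}
    (hV : ∀ κ p, C.stab κ p * V = V) (R : C.Syndrome L → Op (Fin n) →ₗ[ℂ] Op (Fin k))
    {N : C.Noise L} (hN : IsSchurNoise N) (ρ : Op (Fin k)) :
    logicalChannel sch V R N ρ =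
      ∑ d, (∏ γ, diagSum (totalCoeff N γ) (physBits C L d γ)) • pathTerm V R ρ 0 d := by
  have hpaths : logicalChannel sch V R N ρ = ∑ x, ∑ x',
      (∏ γ, totalCoeff N γ (physBits C L x γ) (physBits C L x' γ)) • pathTerm V R ρ x x' := by
    simp only [logicalChannel, branch_eq_foldl_lumpedRound sch hN, foldl_lumpedRound, map_sum,
      map_smul, pathTerm, Finset.smul_sum]
    rw [Finset.sum_comm]
    exact Finset.sum_congr rfl fun x _ => Finset.sum_comm
  rw [hpaths, sum_sum_smul_eq_of_add_invariant _ (pathTerm_add hV R ρ)]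
  simp only [sum_prod_physBits]

/-! ### The coefficients of the noise and of its replacements -/

theorem isSchur_lumped_and_schurCoeff_lumped {N : C.Noise L} (hN : IsSchurNoise N)
    (γ : C.PhysQubit L) :
    IsSchur (lumped N γ) ∧ schurCoeff (lumped N γ) = totalCoeff N γ := by
  suffices h : ∀ ρ a b, lumped N γ ρ a b = totalCoeff N γ a b * ρ a b from
    ⟨isSchur_of_forall h, funext₂ (schurCoeff_eq h)⟩
  have hγ := hN γ
  unfold lumped totalCoeff
  generalize C.numLoc γ = W at hγ
  induction W with
  | zero => simp
  | succ W ih =>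
    have hW := ih fun w hw => hγ w (hw.trans W.lt_succ_self)
    intro ρ a b
    rw [List.range_succ, List.foldl_append, List.foldl_cons, List.foldl_nil,
      comp_apply_of_isSchur (hγ W W.lt_succ_self) (isSchur_of_forall hW), schurCoeff_eq hW,
      Finset.prod_range_succ, mul_comm (∏ w ∈ _, _)]

/-- The number `1 - 2 b_γ`. For noise with pure `Z`-coherences it is the real part of the
coefficient by which all noise on `γ` together multiplies the coherences. -/
def dampingFactor (N : C.Noise L) (γ : C.PhysQubit L) : ℝ := 1 - 2 * zWeight (lumped N γ)

section IsPureZCoherent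

variable {N : C.Noise L} (hN : ∀ γ, ∀ w < C.numLoc γ, IsPureZCoherent (N γ w))
include hN

theorem totalCoeff_self (γ : C.PhysQubit L) (a : Bit) : totalCoeff N γ a a = 1 :=
  Finset.prod_eq_one fun w hw => (hN γ w (Finset.mem_range.mp hw)).schurCoeff_self a

theorem totalCoeff_symm (γ : C.PhysQubit L) (a b : Bit) :
    totalCoeff N γ b a = star (totalCoeff N γ a b) := by
  rw [totalCoeff, totalCoeff, star_prod]
  exact Finset.prod_congr rfl fun w hw => (hN γ w (Finset.mem_range.mp hw)).schurCoeff_symm a b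

theorem dampingFactor_eq (γ : C.PhysQubit L) :
    dampingFactor N γ = (totalCoeff N γ 0 1).re := by
  obtain ⟨hSchur, hcoeff⟩ := isSchur_lumped_and_schurCoeff_lumped
    (fun γ w hw => (hN γ w hw).isSchur) γ
  have hre : (1 + 1 - (totalCoeff N γ 0 1 + star (totalCoeff N γ 0 1))) / 4 =
      ((1 - (totalCoeff N γ 0 1).re) / 2 : ℝ) := by
    rw [Complex.star_def, Complex.add_conj]
    push_cast
    ring
  rw [dampingFactor, hSchur.zWeight_eq, hcoeff, totalCoeff_self hN, totalCoeff_self hN,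
    totalCoeff_symm hN γ 0 1, hre, Complex.ofReal_re]
  ring

theorem abs_dampingFactor_le (γ : C.PhysQubit L) : |dampingFactor N γ| ≤ 1 := by
  rw [dampingFactor_eq hN]
  refine (Complex.abs_re_le_norm _).trans ?_
  rw [totalCoeff, norm_prod]
  exact Finset.prod_le_one (fun _ _ => norm_nonneg _) fun w hw =>
    (hN γ w (Finset.mem_range.mp hw)).norm_schurCoeff_le 0 1

theorem flipProb_mem_Icc (γ : C.PhysQubit L) (w : ℕ) : flipProb N γ w ∈ Set.Icc (0 : ℝ) 1 := by
  have h := abs_le.mp (abs_splitRoot_le (abs_dampingFactor_le hN γ) (C.numLoc γ) w)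
  rw [dampingFactor] at h
  rw [flipProb]
  constructor <;> linarith [h.1, h.2]

end IsPureZCoherent

theorem isSchurNoise_pauliReplacement (N : C.Noise L) : IsSchurNoise (pauliReplacement N) :=
  fun _ _ _ => isSchur_of_forall (phaseFlip_apply _)

theorem isSchurNoise_insertPaulis (e : C.ErrorConfig L) : IsSchurNoise (insertPaulis e) := by
  intro γ w hw
  rw [insertPaulis, dif_pos hw]
  exact isSchur_of_forall (conjBy_pauliZ_pow_apply _)

theorem diagSum_totalCoeff_pauliReplacement (N : C.Noise L) (γ : C.PhysQubit L) (d : Bit) :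
    diagSum (totalCoeff (pauliReplacement N) γ) d =
      2 * ∏ w : Fin (C.numLoc γ), ((1 - flipProb N γ w : ℝ) + flipProb N γ w * sgn d) := by
  refine diagSum_of_eq (f := fun d => ∏ w : Fin (C.numLoc γ),
    ((1 - flipProb N γ w : ℝ) + flipProb N γ w * sgn d)) (fun a b => ?_) d
  rw [totalCoeff, Finset.prod_range]
  exact Finset.prod_congr rfl fun w _ => schurCoeff_eq (phaseFlip_apply _) a b

theorem diagSum_totalCoeff_insertPaulis (e : C.ErrorConfig L) (γ : C.PhysQubit L) (d : Bit) :
    diagSum (totalCoeff (insertPaulis e) γ) d = 2 * ∏ w, sgn (e γ w * d) := by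
  refine diagSum_of_eq (f := fun d => ∏ w, sgn (e γ w * d)) (fun a b => ?_) d
  rw [totalCoeff, Finset.prod_range]
  refine Finset.prod_congr rfl fun w _ => ?_
  rw [insertPaulis, dif_pos w.isLt]
  exact schurCoeff_eq (conjBy_pauliZ_pow_apply _) a b

theorem diagSum_totalCoeff_pauliReplacement_eq {N : C.Noise L}
    (hN : ∀ γ, ∀ w < C.numLoc γ, IsPureZCoherent (N γ w)) (γ : C.PhysQubit L) (d : Bit) :
    diagSum (totalCoeff (pauliReplacement N) γ) d = diagSum (totalCoeff N γ) d := by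
  rw [diagSum_totalCoeff_pauliReplacement, diagSum, sum_bit]
  rcases bit_eq_zero_or_one d with rfl | rfl
  · rw [add_zero, add_zero, totalCoeff_self hN, totalCoeff_self hN, sgn_zero]
    simp only [mul_one, ← Complex.ofReal_add, sub_add_cancel, Complex.ofReal_one,
      Finset.prod_const_one]
    norm_num
  · have hflip : ∀ w, ((1 - flipProb N γ w : ℝ) + flipProb N γ w * sgn 1 : ℂ) =
        splitRoot (dampingFactor N γ) (C.numLoc γ) w := fun w => by
      rw [flipProb, ← dampingFactor, sgn_one]
      push_cast
      ring
    simp only [hflip]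
    rw [← Complex.ofReal_prod, ← Finset.prod_range, prod_splitRoot _ (numLoc_ne_zero γ),
      dampingFactor_eq hN, zero_add, CharTwo.add_self_eq_zero, totalCoeff_symm hN γ 0 1,
      Complex.star_def, Complex.add_conj, Complex.ofReal_mul, Complex.ofReal_ofNat]

theorem sum_configProb_mul_prod_diagSum (N : C.Noise L) (d : C.PhysQubit L → Bit) :
    ∑ e : C.ErrorConfig L, (configProb N e : ℂ) *
        ∏ γ, diagSum (totalCoeff (insertPaulis e) γ) (d γ) =
      ∏ γ, diagSum (totalCoeff (pauliReplacement N) γ) (d γ) := by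
  have hlocation : ∀ γ (w : Fin (C.numLoc γ)),
      ((1 - flipProb N γ w : ℝ) + flipProb N γ w * sgn (d γ) : ℂ) =
        ∑ b : Bit, ((if b = 1 then flipProb N γ w else 1 - flipProb N γ w : ℝ) : ℂ) *
          sgn (b * d γ) := fun γ w => by
    simp [sum_bit]
  simp only [diagSum_totalCoeff_pauliReplacement, diagSum_totalCoeff_insertPaulis, hlocation,
    Fintype.prod_sum, Finset.mul_sum, configProb, Complex.ofReal_prod, Finset.prod_mul_distrib]
  exact Finset.sum_congr rfl fun e _ => by ring

theorem IsEncoder.stab_mul {V : Matrix (Fin n → Bit) (Fin k → Bit) ℂ} (hV : C.IsEncoder V)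
    (κ : Kind) (p : Fin (C.num κ)) : C.stab κ p * V = V := by
  refine Matrix.ext_of_mulVec_single fun x => ?_
  rw [← Matrix.mulVec_mulVec]
  exact (hV.2 _).mp ⟨_, rfl⟩ κ p

end CSSCode

end Foliation

end

open Foliation CSSCode in
theorem corollary2_general {n k L : ℕ} (C : CSSCode n) (sch : C.Schedule L)
    (V : Matrix (Fin n → Bit) (Fin k → Bit) ℂ) (hV : ∀ κ p, C.stab κ p * V = V)
    (R : C.Syndrome L → Op (Fin n) →ₗ[ℂ] Op (Fin k))
    (N : C.Noise L) (hN : ∀ γ, ∀ w < C.numLoc γ, IsPureZCoherent (N γ w)) :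
    (∀ γ, ∀ w < C.numLoc γ, flipProb N γ w ∈ Set.Icc (0 : ℝ) 1 ∧
      IsPauliChannel (pauliReplacement N γ w)) ∧
    logicalChannel sch V R N = logicalChannel sch V R (pauliReplacement N) ∧
    ∀ ρ, logicalChannel sch V R N ρ =
      ∑ e : C.ErrorConfig L, (configProb N e : ℂ) • logicalChannel sch V R (insertPaulis e) ρ := by
  have hlogical : ∀ ρ, logicalChannel sch V R N ρ =
      ∑ d, (∏ γ, diagSum (totalCoeff (pauliReplacement N) γ) (physBits C L d γ)) •
        pathTerm V R ρ 0 d := fun ρ => by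
    simp only [logicalChannel_eq_sum sch hV R (fun γ w hw => (hN γ w hw).isSchur),
      diagSum_totalCoeff_pauliReplacement_eq hN]
  have hprob := flipProb_mem_Icc hN
  refine ⟨fun γ w _ => ⟨hprob γ w, isPauliChannel_phaseFlip (hprob γ w)⟩,
    funext fun ρ => ?_, fun ρ => ?_⟩
  · rw [hlogical, logicalChannel_eq_sum sch hV R (isSchurNoise_pauliReplacement N)]
  · simp only [hlogical, logicalChannel_eq_sum sch hV R (isSchurNoise_insertPaulis _),
      ← sum_configProb_mul_prod_diagSum, Finset.sum_smul, Finset.smul_sum, smul_smul]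
    exact Finset.sum_comm

open Foliation CSSCode in
theorem corollary2 {n k L : ℕ} (C : CSSCode n) (sch : C.Schedule L)
    (V : Matrix (Fin n → Bit) (Fin k → Bit) ℂ) (hV : C.IsEncoder V)
    (R : C.Syndrome L → Op (Fin n) →ₗ[ℂ] Op (Fin k)) (hR : ∀ σ, IsChannel (R σ))
    (N : C.Noise L) (hN : ∀ γ, ∀ w < C.numLoc γ, IsPureZCoherent (N γ w)) :
    (∀ γ, ∀ w < C.numLoc γ, flipProb N γ w ∈ Set.Icc (0 : ℝ) 1 ∧
      IsPauliChannel (pauliReplacement N γ w)) ∧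
    logicalChannel sch V R N = logicalChannel sch V R (pauliReplacement N) ∧
    ∀ ρ, logicalChannel sch V R N ρ =
      ∑ e : C.ErrorConfig L, (configProb N e : ℂ) • logicalChannel sch V R (insertPaulis e) ρ :=
  corollary2_general C sch V hV.stab_mul R N hN
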